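/- Let $L$ be a compact connected Lie group with Lie algebra $\mathfrak l$, and let $L^{\mathbb C}$ be its complexification, i.e. a complex Lie group containing $L$, with Lie algebra $\mathfrak l^{\mathbb C}=\mathfrak l\oplus\sqrt{-1}\,\mathfrak l$, such that $L\times\mathfrak l\to L^{\mathbb C}$, $(a,\xi)\mapsto a\,e^{\sqrt{-1}\xi}$, is a diffeomorphism. Let $L^{\mathbb C}$ act holomorphically on a finite-dimensional Hausdorff complex manifold $(X,I)$ with Kähler metric $g$ and Kähler form $\omega=g(I\cdot,\cdot)$, let $L$ act by isometries, and let $m:X\to\mathfrak l^*$ be an ($L$-equivariant) moment map for the action of $L$ on $(X,\omega)$, with the convention $d\langle m,\xi\rangle=\omega(\xi^*,\cdot)$, where $\xi^*$ is the vector field on $X$ generated by $\xi\in\mathfrak l$. Let $\zeta\in\mathfrak l^*$ be fixed by the coadjoint action of $L$. For $x\in X$ let $\alpha_{x,\zeta}$ be the $1$-form on $L\backslash L^{\mathbb C}$ given by $$(\alpha_{x,\zeta})_{Lg}(\xi_g)=\langle m(gx)-\zeta,\xi\rangle,\qquad \xi_g=\frac{d}{dt}\Big|_{t=0}Le^{\sqrt{-1}t\xi}g\quad(\xi\in\mathfrak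 l,\ g\in L^{\mathbb C}).$$ Write $\mathrm{Stab}(x)^{\mathbb C}=\{g\in L^{\mathbb C}: gx=x\}$, let $\mathrm{stab}(x)^{\mathbb C}\subset\mathfrak l^{\mathbb C}$ be its Lie algebra, and let $\widetilde{\mathrm{stab}}(x)\subset\mathfrak l$ be the image of $\mathrm{stab}(x)^{\mathbb C}$ under $a+\sqrt{-1}b\mapsto b$ $(a,b\in\mathfrak l)$. **Proposition 4.8.** For every $x\in X$ there is a unique function $\Phi_{x,\zeta}:L\backslash L^{\mathbb C}\to\mathbb R$ with $d\Phi_{x,\zeta}=\alpha_{x,\zeta}$ and $\Phi_{x,\zeta}(L\cdot 1)=0$. The function $\Phi_{x,\zeta}$ has a critical point if and only if there is some $g\in L^{\mathbb C}$ such that both of the following hold: (i) $\Phi_{gx,\zeta}$ is $\mathrm{Stab}(gx)^{\mathbb C}$-invariant, i.e. $\Phi_{gx,\zeta}(Lh\gamma)=\Phi_{gx,\zeta}(Lh)$ for all $h\in L^{\mathbb C}$ and $\gamma\in\mathrm{Stab}(gx)^{\mathbb C}$; (ii) $\lim_{t\to\infty}\Phi_{gx,\zeta}(Le^{\sqrt{-1}t\xi})=\infty$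 for every $\xi\in\mathfrak l\setminus\widetilde{\mathrm{stab}}(gx)$. -/

import Mathlib

open Set Filter Topology Manifold
open scoped ContDiff

noncomputable section

/-! ### Complex manifolds as real manifolds -/

/-- A complex manifold is, with the same charts, a real analytic manifold. -/
instance isManifold_real_of_complex {E : Type*} [NormedAddCommGroup E] [NormedSpace ℂ E]
    {M : Type*} [TopologicalSpace M] [ChartedSpace E M] [h : IsManifold 𝓘(ℂ, E) ω M] :
    IsManifold 𝓘(ℝ, E) ω M := by
  apply isManifold_of_contDiffOn
  intro e e' he he'
  have h1 := h.compatible he he'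
  rw [contDiffGroupoid, mem_groupoid_of_pregroupoid] at h1
  exact ContDiffOn.restrict_scalars ℝ h1.1

section ComplexStructure

variable {E : Type*} [NormedAddCommGroup E] [NormedSpace ℂ E]
  {M : Type*} [TopologicalSpace M] [ChartedSpace E M]

/-- Multiplication by `√-1` on the (real) tangent space of a complex manifold. -/
def tangentI (x : M) : TangentSpace 𝓘(ℝ, E) x →L[ℝ] TangentSpace 𝓘(ℝ, E) x :=
  ((Complex.I • ContinuousLinearMap.id ℂ E).restrictScalars ℝ : E →L[ℝ] E)

end ComplexStructure

/-! ### Kähler metrics -/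

section Kahler

variable {E : Type*} [NormedAddCommGroup E] [NormedSpace ℂ E]
  {X : Type*} [TopologicalSpace X] [ChartedSpace E X] [IsManifold 𝓘(ℂ, E) ω X]

/-- The form `ω(u, v) = g(√-1 u, v)` associated with a Riemannian metric `g` on a complex
manifold. -/
def fundamentalForm
    (g : Bundle.ContMDiffRiemannianMetric 𝓘(ℝ, E) ∞ E (fun x : X ↦ TangentSpace 𝓘(ℝ, E) x))
    (x : X) (u v : TangentSpace 𝓘(ℝ, E) x) : ℝ :=
  g.inner x (tangentI x u) v

/-- The expression of the fundamental form in the chart around `x₀`: its pullback under the inverse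
of the chart, evaluated at the point `y` of the chart's target on the vectors `u, v`. -/
def fundamentalFormInChart
    (g : Bundle.ContMDiffRiemannianMetric 𝓘(ℝ, E) ∞ E (fun x : X ↦ TangentSpace 𝓘(ℝ, E) x))
    (x₀ : X) (y u v : E) : ℝ :=
  fundamentalForm g ((extChartAt 𝓘(ℝ, E) x₀).symm y)
    (mfderiv 𝓘(ℝ, E) 𝓘(ℝ, E) (extChartAt 𝓘(ℝ, E) x₀).symm y u)
    (mfderiv 𝓘(ℝ, E) 𝓘(ℝ, E) (extChartAt 𝓘(ℝ, E) x₀).symm y v)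

variable (E X) in
/-- A Kähler metric on the complex manifold `X`: a smooth Riemannian metric for which `√-1` is
isometric and whose fundamental form is closed. The last field is `dω (u, v, w) = 0`, written in
charts for constant vector fields `u, v, w`. -/
structure KahlerMetric extends
    Bundle.ContMDiffRiemannianMetric 𝓘(ℝ, E) ∞ E (fun x : X ↦ TangentSpace 𝓘(ℝ, E) x) where
  hermitian : ∀ (x : X) (u v : TangentSpace 𝓘(ℝ, E) x),
    inner x (tangentI x u) (tangentI x v) = inner x u v
  closed : ∀ (x₀ : X), ∀ y ∈ (extChartAt 𝓘(ℝ, E) x₀).target, ∀ u v w : E,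
    fderiv ℝ (fun z ↦ fundamentalFormInChart toContMDiffRiemannianMetric x₀ z v w) y u
      + fderiv ℝ (fun z ↦ fundamentalFormInChart toContMDiffRiemannianMetric x₀ z w u) y v
      + fderiv ℝ (fun z ↦ fundamentalFormInChart toContMDiffRiemannianMetric x₀ z u v) y w = 0

/-- The Kähler form `ω(u, v) = g(√-1 u, v)`. -/
def KahlerMetric.form (g : KahlerMetric E X) (x : X) (u v : TangentSpace 𝓘(ℝ, E) x) : ℝ :=
  fundamentalForm g.toContMDiffRiemannianMetric x u v

end Kahler

/-! ### Exponential map and adjoint action of a Lie group -/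

section Exponential

variable {E : Type*} [NormedAddCommGroup E] [NormedSpace ℝ E]
  {G : Type*} [Group G] [TopologicalSpace G] [ChartedSpace E G]

/-- `γ : ℝ → G` is the one-parameter subgroup with initial velocity `v`. -/
def IsOneParameterSubgroup (γ : ℝ → G) (v : GroupLieAlgebra 𝓘(ℝ, E) G) : Prop :=
  (∀ s t, γ (s + t) = γ s * γ t) ∧
    HasMFDerivAt 𝓘(ℝ, ℝ) 𝓘(ℝ, E) γ 0 (ContinuousLinearMap.toSpanSingleton ℝ (v : E))

open Classical in
/-- The exponential map of a Lie group: the value at time `1` of the one-parameter subgroup with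
initial velocity `v` (which exists and is unique on a finite-dimensional Lie group; the default
value `1` is never used there). -/
def lieExp (v : GroupLieAlgebra 𝓘(ℝ, E) G) : G :=
  if h : ∃ γ : ℝ → G, IsOneParameterSubgroup γ v then h.choose 1 else 1

/-- The adjoint action `Ad_a` on the Lie algebra: the derivative at `1` of `h ↦ a h a⁻¹`. -/
def lieAd (a : G) (v : GroupLieAlgebra 𝓘(ℝ, E) G) : GroupLieAlgebra 𝓘(ℝ, E) G :=
  (mfderiv 𝓘(ℝ, E) 𝓘(ℝ, E) (fun h : G ↦ a * h * a⁻¹) 1 v : E)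

end Exponential

/-! ### Complexification of a compact Lie group -/

section Complexification

variable {EL : Type*} [NormedAddCommGroup EL] [NormedSpace ℝ EL]
  {EK : Type*} [NormedAddCommGroup EK] [NormedSpace ℂ EK]
  {L : Type*} [Group L] [TopologicalSpace L] [ChartedSpace EL L]
  {K : Type*} [Group K] [TopologicalSpace K] [ChartedSpace EK K]

/-- The homomorphism of Lie algebras induced by a smooth homomorphism of Lie groups. -/
def lieMap (ι : L →* K) (ξ : GroupLieAlgebra 𝓘(ℝ, EL) L) : GroupLieAlgebra 𝓘(ℝ, EK) K :=
  (mfderiv 𝓘(ℝ, EL) 𝓘(ℝ, EK) (ι : L → K) 1 ξ : EK)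

/-- The element `a + √-1 b` of the Lie algebra of `L^ℂ`, for `a, b` in the Lie algebra of `L`. -/
def complexLie (ι : L →* K) (a b : GroupLieAlgebra 𝓘(ℝ, EL) L) : GroupLieAlgebra 𝓘(ℝ, EK) K :=
  lieMap ι a + tangentI (1 : K) (lieMap ι b)

/-- The element `e^{√-1 ξ}` of `L^ℂ`, for `ξ` in the Lie algebra of `L`. -/
def expI (ι : L →* K) (ξ : GroupLieAlgebra 𝓘(ℝ, EL) L) : K :=
  lieExp (complexLie (EK := EK) ι 0 ξ)

/-- The homomorphism `ι : L →* K` from a compact Lie group to a complex Lie group is a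
complexification: it is smooth, the Lie algebra of `K` is `𝔩 ⊕ √-1 𝔩`, and
`(a, ξ) ↦ a e^{√-1 ξ}` is a diffeomorphism from `L × 𝔩` to `K`. -/
structure IsComplexification (ι : L →* K) : Prop where
  contMDiff : ContMDiff 𝓘(ℝ, EL) 𝓘(ℝ, EK) ∞ ι
  lieAlgebra : ∀ v : GroupLieAlgebra 𝓘(ℝ, EK) K,
    ∃! p : GroupLieAlgebra 𝓘(ℝ, EL) L × GroupLieAlgebra 𝓘(ℝ, EL) L, complexLie ι p.1 p.2 = v
  polar : ∃ D : Diffeomorph (𝓘(ℝ, EL).prod 𝓘(ℝ, EL)) 𝓘(ℝ, EK) (L × EL) K ∞,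
    ∀ (a : L) (ξ : EL), D (a, ξ) = ι a * expI (EL := EL) (EK := EK) ι ξ

/-- The homogeneous space `L \ L^ℂ` of cosets `L g`. -/
abbrev LeftQuotient (ι : L →* K) : Type _ := Quotient (QuotientGroup.rightRel ι.range)

/-- The coset `L g`. -/
def leftCoset (ι : L →* K) (g : K) : LeftQuotient ι := Quotient.mk _ g

/-- `f : L \ L^ℂ → ℝ` is differentiable: as `g ↦ L g` is a submersion, this is tested on `L^ℂ`. -/
def DifferentiableOnQuotient (ι : L →* K) (f : LeftQuotient ι → ℝ) : Prop :=
  MDifferentiable 𝓘(ℝ, EK) 𝓘(ℝ, ℝ) (fun g : K ↦ f (leftCoset ι g))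

/-- `f : L \ L^ℂ → ℝ` has a critical point: `df = 0` at some `L g`, that is (since `g ↦ L g` is a
submersion), the pullback of `f` to `L^ℂ` has vanishing differential at `g`. -/
def HasCriticalPoint (ι : L →* K) (f : LeftQuotient ι → ℝ) : Prop :=
  ∃ g : K, HasMFDerivAt 𝓘(ℝ, EK) 𝓘(ℝ, ℝ) (fun h : K ↦ f (leftCoset ι h)) g
    (0 : EK →L[ℝ] ℝ)

end Complexification

/-! ### Hamiltonian actions and the functions `Φ_{x,ζ}` -/

section Hamiltonian

variable {EL : Type*} [NormedAddCommGroup EL] [NormedSpace ℝ EL]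
  {EK : Type*} [NormedAddCommGroup EK] [NormedSpace ℂ EK]
  {EX : Type*} [NormedAddCommGroup EX] [NormedSpace ℂ EX]
  {L : Type*} [Group L] [TopologicalSpace L] [ChartedSpace EL L]
  {K : Type*} [Group K] [TopologicalSpace K] [ChartedSpace EK K]
  {X : Type*} [TopologicalSpace X] [ChartedSpace EX X] [MulAction K X]

/-- The value at `x` of the vector field on `X` generated by `ξ` in the Lie algebra of `L`:
the derivative at `1` of `a ↦ a x`. -/
def fundamentalVector (ι : L →* K) (ξ : GroupLieAlgebra 𝓘(ℝ, EL) L) (x : X) :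
    TangentSpace 𝓘(ℝ, EX) x :=
  (mfderiv 𝓘(ℝ, EL) 𝓘(ℝ, EX) (fun a : L ↦ ι a • x) 1 ξ : EX)

/-- `L` acts by isometries of the Kähler metric. -/
def ActsIsometrically [IsManifold 𝓘(ℂ, EX) ω X] (ι : L →* K) (g : KahlerMetric EX X) : Prop :=
  ∀ (a : L) (x : X) (u v : TangentSpace 𝓘(ℝ, EX) x),
    g.inner (ι a • x) (mfderiv 𝓘(ℝ, EX) 𝓘(ℝ, EX) (fun y : X ↦ ι a • y) x u)
      (mfderiv 𝓘(ℝ, EX) 𝓘(ℝ, EX) (fun y : X ↦ ι a • y) x v) = g.inner x u v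

/-- `m : X → 𝔩^*` is a moment map for the action of `L` on `(X, ω)`: it is smooth,
`d⟨m, ξ⟩ = ω(ξ^*, ·)` for the vector field `ξ^*` generated by `ξ`, and it is equivariant for the
coadjoint action, `⟨m (a x), ξ⟩ = ⟨m x, Ad_{a⁻¹} ξ⟩`. -/
structure IsMomentMap [IsManifold 𝓘(ℂ, EX) ω X] (ι : L →* K) (g : KahlerMetric EX X)
    (m : X → Module.Dual ℝ (GroupLieAlgebra 𝓘(ℝ, EL) L)) : Prop where
  contMDiff : ∀ ξ, ContMDiff 𝓘(ℝ, EX) 𝓘(ℝ, ℝ) ∞ (fun x ↦ m x ξ)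
  hamiltonian : ∀ ξ (x : X) (v : TangentSpace 𝓘(ℝ, EX) x),
    (mfderiv 𝓘(ℝ, EX) 𝓘(ℝ, ℝ) (fun y ↦ m y ξ) x v : ℝ) = g.form x (fundamentalVector ι ξ x) v
  equivariant : ∀ (a : L) (x : X) ξ, m (ι a • x) ξ = m x (lieAd a⁻¹ ξ)

/-- `Φ` is a primitive of the `1`-form `α_{x,ζ}` on `L \ L^ℂ`, normalized by `Φ (L 1) = 0`. Here
`α_{x,ζ}` is given at `L g` by `ξ_g ↦ ⟨m (g x) - ζ, ξ⟩`, where `ξ_g` is the velocity at `t = 0` of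
the curve `L e^{√-1 t ξ} g`; the vectors `ξ_g` exhaust the tangent space at `L g`. -/
structure IsNormalizedPrimitive (ι : L →* K)
    (m : X → Module.Dual ℝ (GroupLieAlgebra 𝓘(ℝ, EL) L))
    (ζ : Module.Dual ℝ (GroupLieAlgebra 𝓘(ℝ, EL) L)) (x : X)
    (Φ : LeftQuotient ι → ℝ) : Prop where
  differentiable : DifferentiableOnQuotient (EK := EK) ι Φ
  deriv_eq : ∀ (g : K) (ξ : GroupLieAlgebra 𝓘(ℝ, EL) L),
    HasDerivAt (fun t : ℝ ↦ Φ (leftCoset ι (expI (EK := EK) ι (t • ξ) * g)))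
      ((m (g • x) - ζ) ξ) 0
  normalized : Φ (leftCoset ι 1) = 0

variable (EK) in
/-- The function `Φ_{x,ζ} : L \ L^ℂ → ℝ`, the normalized primitive of `α_{x,ζ}`. -/
def potential (ι : L →* K) (m : X → Module.Dual ℝ (GroupLieAlgebra 𝓘(ℝ, EL) L))
    (ζ : Module.Dual ℝ (GroupLieAlgebra 𝓘(ℝ, EL) L)) (x : X) : LeftQuotient ι → ℝ :=
  Classical.epsilon (IsNormalizedPrimitive (EK := EK) ι m ζ x)

variable (EK K) in
/-- The Lie algebra of the closed subgroup `Stab(x)^ℂ = {g ∈ L^ℂ | g x = x}` of `L^ℂ`. -/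
def stabLie (x : X) : Set (GroupLieAlgebra 𝓘(ℝ, EK) K) :=
  {v | ∀ t : ℝ, lieExp (t • v) ∈ MulAction.stabilizer K x}

variable (EL EK) in
/-- The image of the Lie algebra of `Stab(x)^ℂ` under `a + √-1 b ↦ b`. -/
def stabIm (ι : L →* K) (x : X) : Set (GroupLieAlgebra 𝓘(ℝ, EL) L) :=
  {b | ∃ a : GroupLieAlgebra 𝓘(ℝ, EL) L, complexLie (EK := EK) ι a b ∈ stabLie EK K x}

end Hamiltonian

end

/-!
Replacing `m` by `m - ζ` one may take `ζ = 0`. The polar decomposition identifies `L \ L^ℂ` with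
`𝔩` through `ξ ↦ L e^{√-1 ξ}`, and there `Φ_x` is the radial integral of `α_x`; the symmetry
needed for `dΦ_x = α_x` comes from the differential equation satisfied by the logarithmic
derivative of the exponential map together with the infinitesimal equivariance of `m`.

Along the geodesics `t ↦ L e^{√-1 t ξ} k` the second derivative of `Φ_x` is `|ξ^*|² ≥ 0`, so
`Φ_x` is convex there and its critical points, the points `L k` with `m (k x) = 0`, are its
minima. The cocycle identity `Φ_x (L h k) = Φ_{k x} (L h) + Φ_x (L k)` moves a critical point
`L k` of `Φ_x` to the point `L 1`, where convexity gives (i) and (ii) for `k x`.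

Conversely, assume (i) and (ii) at `y = k x` and let `ξ n` be a shortest minimiser of `Φ_y` on
the ball of radius `n` of `𝔩`, for an `Ad`-invariant norm. If no `ξ n` is a global minimiser,
then the `ξ n` tend to infinity. Moving `ξ n` by the stabilizer of `y` does not change `Φ_y`, so
the Gauss lemma makes `ξ n` orthogonal to `stabIm y`. A limit `u` of the directions of the `ξ n`
is then a unit vector outside `stabIm y` along which the convex function `Φ_y` stays bounded
above, contradicting (ii).
-/

noncomputable section

/-! ### Derivatives in the model spaces -/

section ModelDeriv

variable {𝕜 : Type*} [NontriviallyNormedField 𝕜]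
  {E : Type*} [NormedAddCommGroup E] [NormedSpace 𝕜 E]
  {E' : Type*} [NormedAddCommGroup E'] [NormedSpace 𝕜 E']
  {E'' : Type*} [NormedAddCommGroup E''] [NormedSpace 𝕜 E'']
  {M : Type*} [TopologicalSpace M] [ChartedSpace E M]
  {M' : Type*} [TopologicalSpace M'] [ChartedSpace E' M']
  {M'' : Type*} [TopologicalSpace M''] [ChartedSpace E'' M'']

variable (𝕜) in
/-- Differentiability at a point of a map between manifolds modelled on normed spaces. The
derivative is a linear map between the model spaces rather than between tangent spaces, so that
derivatives at different base points can be added and composed. -/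
def HasModelDerivAt (f : M → M') (x : M) (f' : E →L[𝕜] E') : Prop :=
  HasMFDerivAt 𝓘(𝕜, E) 𝓘(𝕜, E') f x f'

variable (𝕜 E E') in
/-- The derivative `mfderiv` of a map between manifolds modelled on normed spaces, as a linear map
between the model spaces. -/
def modelDeriv (f : M → M') (x : M) : E →L[𝕜] E' :=
  mfderiv 𝓘(𝕜, E) 𝓘(𝕜, E') f x

theorem hasModelDerivAt_modelDeriv {f : M → M'} {x : M}
    (h : MDifferentiableAt 𝓘(𝕜, E) 𝓘(𝕜, E') f x) :
    HasModelDerivAt 𝕜 f x (modelDeriv 𝕜 E E' f x) :=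
  h.hasMFDerivAt

theorem HasModelDerivAt.modelDeriv_eq {f : M → M'} {x : M} {f' : E →L[𝕜] E'}
    (h : HasModelDerivAt 𝕜 f x f') : modelDeriv 𝕜 E E' f x = f' :=
  HasMFDerivAt.mfderiv h

theorem HasModelDerivAt.unique {f : M → M'} {x : M} {f₁ f₂ : E →L[𝕜] E'}
    (h₁ : HasModelDerivAt 𝕜 f x f₁) (h₂ : HasModelDerivAt 𝕜 f x f₂) : f₁ = f₂ :=
  h₁.modelDeriv_eq.symm.trans h₂.modelDeriv_eq

theorem HasModelDerivAt.comp {g : M' → M''} {f : M → M'} {x : M} {y : M'}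
    {g' : E' →L[𝕜] E''} {f' : E →L[𝕜] E'}
    (hg : HasModelDerivAt 𝕜 g y g') (hf : HasModelDerivAt 𝕜 f x f') (hy : f x = y) :
    HasModelDerivAt 𝕜 (fun z ↦ g (f z)) x (g'.comp f') := by
  subst hy
  exact HasMFDerivAt.comp x hg hf

theorem HasModelDerivAt.congr {f g : M → M'} {x : M} {f' : E →L[𝕜] E'}
    (h : HasModelDerivAt 𝕜 f x f') (hfg : ∀ᶠ z in 𝓝 x, g z = f z) : HasModelDerivAt 𝕜 g x f' :=
  HasMFDerivAt.congr_of_eventuallyEq h hfg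

theorem hasModelDerivAt_const (c : M') (x : M) :
    HasModelDerivAt 𝕜 (fun _ : M ↦ c) x (0 : E →L[𝕜] E') :=
  hasMFDerivAt_const c x

theorem hasModelDerivAt_id (x : M) :
    HasModelDerivAt 𝕜 (fun z : M ↦ z) x (ContinuousLinearMap.id 𝕜 E) :=
  hasMFDerivAt_id x

theorem hasModelDerivAt_iff_hasFDerivAt {f : E → E'} {x : E} {f' : E →L[𝕜] E'} :
    HasModelDerivAt 𝕜 f x f' ↔ HasFDerivAt f f' x :=
  hasMFDerivAt_iff_hasFDerivAt

/-- The curve `γ` in a manifold has velocity `v`, read in the model space, at the time `t`. -/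
def HasVelocityAt (γ : 𝕜 → M) (v : E) (t : 𝕜) : Prop :=
  HasModelDerivAt 𝕜 γ t (ContinuousLinearMap.toSpanSingleton 𝕜 v)

theorem HasVelocityAt.unique {γ : 𝕜 → M} {v w : E} {t : 𝕜} (hv : HasVelocityAt γ v t)
    (hw : HasVelocityAt γ w t) : v = w := by
  simpa using DFunLike.congr_fun (HasModelDerivAt.unique hv hw) 1

theorem HasModelDerivAt.comp_velocity {f : M → M'} {x : M} {f' : E →L[𝕜] E'}
    {γ : 𝕜 → M} {t : 𝕜} {v : E} (hf : HasModelDerivAt 𝕜 f x f') (hγ : HasVelocityAt γ v t)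
    (hx : γ t = x) : HasVelocityAt (fun s ↦ f (γ s)) (f' v) t := by
  have h := hf.comp hγ hx
  rwa [ContinuousLinearMap.comp_toSpanSingleton] at h

theorem hasVelocityAt_iff_hasDerivAt {f : 𝕜 → E} {t : 𝕜} {v : E} :
    HasVelocityAt f v t ↔ HasDerivAt f v t :=
  hasModelDerivAt_iff_hasFDerivAt

theorem HasVelocityAt.comp_hasDerivAt {γ : 𝕜 → M} {v : E} {τ : 𝕜 → 𝕜} {t c : 𝕜}
    (hγ : HasVelocityAt γ v (τ t)) (hτ : HasDerivAt τ c t) :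
    HasVelocityAt (fun s ↦ γ (τ s)) (c • v) t := by
  simpa using HasModelDerivAt.comp_velocity hγ (hasVelocityAt_iff_hasDerivAt.2 hτ) rfl

/-- If `f z b` does not depend on `z`, all these derivatives live between the same two tangent
spaces, so no coordinate change enters. -/
theorem contMDiffAt_modelDeriv_of_const [IsManifold 𝓘(𝕜, E) ∞ M] [IsManifold 𝓘(𝕜, E') ∞ M']
    [IsManifold 𝓘(𝕜, E'') ∞ M'']
    {f : M'' → M → M'} {z₀ : M''} {b : M} {c : M'}
    (hf : ContMDiffAt (𝓘(𝕜, E'').prod 𝓘(𝕜, E)) 𝓘(𝕜, E') ∞ (Function.uncurry f) (z₀, b))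
    (hc : ∀ z, f z b = c) :
    ContMDiffAt 𝓘(𝕜, E'') 𝓘(𝕜, E →L[𝕜] E') ∞ (fun z ↦ modelDeriv 𝕜 E E' (f z) b) z₀ := by
  have : IsManifold 𝓘(𝕜, E) 1 M := .of_le (n := ∞) (by simp)
  have : IsManifold 𝓘(𝕜, E') 1 M' := .of_le (n := ∞) (by simp)
  have : IsManifold 𝓘(𝕜, E'') 1 M'' := .of_le (n := ∞) (by simp)
  refine (ContMDiffAt.mfderiv (m := ∞) f (fun _ ↦ b) hf contMDiffAt_const
    (by simp)).congr_of_eventuallyEq (.of_forall fun z ↦ ?_)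
  refine Eq.trans ?_ (inTangentCoordinates_eq (I := 𝓘(𝕜, E)) (I' := 𝓘(𝕜, E')) (fun _ ↦ b)
    (fun z ↦ f z b) (fun z ↦ modelDeriv 𝕜 E E' (f z) b) (mem_chart_source E b)
    (by simpa only [hc] using mem_chart_source E' c)).symm
  ext v
  simp only [hc, ContinuousLinearMap.comp_apply]
  rw [(tangentBundleCore 𝓘(𝕜, E) M).coordChange_self _ _ (mem_chart_source E b),
    (tangentBundleCore 𝓘(𝕜, E') M').coordChange_self _ _ (mem_chart_source E' c)]

end ModelDeriv

section RestrictScalars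

variable {E : Type*} [NormedAddCommGroup E] [NormedSpace ℂ E]
  {E₁ : Type*} [NormedAddCommGroup E₁] [NormedSpace ℂ E₁]
  {E' : Type*} [NormedAddCommGroup E'] [NormedSpace ℂ E']
  {M : Type*} [TopologicalSpace M] [ChartedSpace E M]
  {M₁ : Type*} [TopologicalSpace M₁] [ChartedSpace E₁ M₁]
  {M' : Type*} [TopologicalSpace M'] [ChartedSpace E' M']

theorem HasModelDerivAt.restrictScalars_real {f : M → M'} {x : M} {f' : E →L[ℂ] E'}
    (h : HasModelDerivAt ℂ f x f') : HasModelDerivAt ℝ f x (f'.restrictScalars ℝ) :=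
  ⟨h.1, HasFDerivWithinAt.restrictScalars ℝ h.2⟩

theorem contMDiff_real_of_complex {n : WithTop ℕ∞} {f : M → M'}
    (h : ContMDiff 𝓘(ℂ, E) 𝓘(ℂ, E') n f) : ContMDiff 𝓘(ℝ, E) 𝓘(ℝ, E') n f := fun x ↦
  have hx := contMDiffAt_iff.1 (h x)
  contMDiffAt_iff.2 ⟨hx.1, ContDiffWithinAt.restrict_scalars ℝ hx.2⟩

theorem contMDiff_real_of_complex_prod {n : WithTop ℕ∞} {f : M × M₁ → M'}
    (h : ContMDiff (𝓘(ℂ, E).prod 𝓘(ℂ, E₁)) 𝓘(ℂ, E') n f) :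
    ContMDiff (𝓘(ℝ, E).prod 𝓘(ℝ, E₁)) 𝓘(ℝ, E') n f := fun x ↦
  have hx := contMDiffAt_iff.1 (h x)
  contMDiffAt_iff.2 ⟨hx.1, ContDiffWithinAt.restrict_scalars ℝ hx.2⟩

instance lieGroup_real_of_complex {G : Type*} [Group G] [TopologicalSpace G] [ChartedSpace E G]
    [h : LieGroup 𝓘(ℂ, E) ω G] : LieGroup 𝓘(ℝ, E) ω G where
  toIsManifold := isManifold_real_of_complex
  contMDiff_mul := contMDiff_real_of_complex_prod (contMDiff_mul 𝓘(ℂ, E) ω)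
  contMDiff_inv := contMDiff_real_of_complex h.contMDiff_inv

end RestrictScalars

section LieGroupDeriv

variable {𝕜 : Type*} [NontriviallyNormedField 𝕜]
  {E : Type*} [NormedAddCommGroup E] [NormedSpace 𝕜 E]
  {E' : Type*} [NormedAddCommGroup E'] [NormedSpace 𝕜 E']
  {G : Type*} [Group G] [TopologicalSpace G] [ChartedSpace E G] [LieGroup 𝓘(𝕜, E) ∞ G]
  {M : Type*} [TopologicalSpace M] [ChartedSpace E' M]

variable (𝕜 E G) in
theorem hasMFDerivAt_mul_one_one :
    HasMFDerivAt (𝓘(𝕜, E).prod 𝓘(𝕜, E)) 𝓘(𝕜, E) (fun p : G × G ↦ p.1 * p.2) (1, 1)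
      (ContinuousLinearMap.fst 𝕜 E E + ContinuousLinearMap.snd 𝕜 E E : E × E →L[𝕜] E) := by
  have hmul : MDifferentiableAt (𝓘(𝕜, E).prod 𝓘(𝕜, E)) 𝓘(𝕜, E)
      (fun p : G × G ↦ p.1 * p.2) (1, 1) :=
    (contMDiff_mul 𝓘(𝕜, E) ∞).mdifferentiable (by simp) _
  have hfst : modelDeriv 𝕜 E E (fun z : G ↦ z * 1) 1 = ContinuousLinearMap.id 𝕜 E := by
    simpa only [mul_one] using (hasModelDerivAt_id (1 : G)).modelDeriv_eq
  have hsnd : modelDeriv 𝕜 E E (fun z : G ↦ 1 * z) 1 = ContinuousLinearMap.id 𝕜 E := by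
    simpa only [one_mul] using (hasModelDerivAt_id (1 : G)).modelDeriv_eq
  suffices (mfderiv (𝓘(𝕜, E).prod 𝓘(𝕜, E)) 𝓘(𝕜, E) (fun p : G × G ↦ p.1 * p.2) (1, 1) :
      E × E →L[𝕜] E) = ContinuousLinearMap.fst 𝕜 E E + ContinuousLinearMap.snd 𝕜 E E from
    this ▸ hmul.hasMFDerivAt
  refine ContinuousLinearMap.ext fun v ↦ (mfderiv_prod_eq_add_apply (v := v) hmul).trans ?_
  change modelDeriv 𝕜 E E (fun z : G ↦ z * 1) 1 v.1
    + modelDeriv 𝕜 E E (fun z : G ↦ 1 * z) 1 v.2 = _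
  rw [hfst, hsnd]
  rfl

theorem HasModelDerivAt.mul_of_eq_one {f g : M → G} {x : M} {f' g' : E' →L[𝕜] E}
    (hf : HasModelDerivAt 𝕜 f x f') (hg : HasModelDerivAt 𝕜 g x g') (hfx : f x = 1)
    (hgx : g x = 1) : HasModelDerivAt 𝕜 (fun z ↦ f z * g z) x (f' + g') := by
  have hmul := hasMFDerivAt_mul_one_one 𝕜 E G
  rw [← hfx, ← congrArg (Prod.mk (f x)) (hgx.trans hfx.symm)] at hmul
  exact HasMFDerivAt.comp x hmul (HasMFDerivAt.prodMk hf hg)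

theorem hasModelDerivAt_inv_one :
    HasModelDerivAt 𝕜 (fun a : G ↦ a⁻¹) 1 (-ContinuousLinearMap.id 𝕜 E) := by
  have hinv : HasModelDerivAt 𝕜 (fun a : G ↦ a⁻¹) 1 (modelDeriv 𝕜 E E (fun a : G ↦ a⁻¹) 1) :=
    hasModelDerivAt_modelDeriv ((contMDiff_inv 𝓘(𝕜, E) (n := ∞)).mdifferentiable (by simp) 1)
  have hmul := (hasModelDerivAt_id (𝕜 := 𝕜) (E := E) (1 : G)).mul_of_eq_one hinv rfl inv_one
  simp only [mul_inv_cancel] at hmul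
  rwa [eq_neg_of_add_eq_zero_right (hmul.unique (hasModelDerivAt_const 1 1))] at hinv

variable (𝕜 E)

theorem hasModelDerivAt_mul_left (a b : G) :
    HasModelDerivAt 𝕜 (fun h : G ↦ a * h) b (modelDeriv 𝕜 E E (fun h : G ↦ a * h) b) :=
  hasModelDerivAt_modelDeriv ((contMDiff_mul_left (n := ∞)).mdifferentiable (by simp) b)

theorem hasModelDerivAt_mul_right (a b : G) :
    HasModelDerivAt 𝕜 (fun h : G ↦ h * a) b (modelDeriv 𝕜 E E (fun h : G ↦ h * a) b) :=
  hasModelDerivAt_modelDeriv ((contMDiff_mul_right (n := ∞)).mdifferentiable (by simp) b)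

/-- The adjoint action `Ad_k` of a Lie group on its Lie algebra, as a continuous linear map. -/
def lieGroupAd (k : G) : E →L[𝕜] E := modelDeriv 𝕜 E E (fun h : G ↦ k * h * k⁻¹) 1

theorem hasModelDerivAt_conj (k : G) :
    HasModelDerivAt 𝕜 (fun h : G ↦ k * h * k⁻¹) 1 (lieGroupAd 𝕜 E k) := by
  have hconj := (contMDiff_mul_right (I := 𝓘(𝕜, E)) (n := ∞) (a := k⁻¹)).comp
    (contMDiff_mul_left (a := k))
  exact hasModelDerivAt_modelDeriv (hconj.mdifferentiable (by simp) 1)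

theorem lieGroupAd_mul (k l : G) (v : E) :
    lieGroupAd 𝕜 E (k * l) v = lieGroupAd 𝕜 E k (lieGroupAd 𝕜 E l v) := by
  have hcomp := (hasModelDerivAt_conj 𝕜 E k).comp (hasModelDerivAt_conj 𝕜 E l) (by simp)
  have hmul := hasModelDerivAt_conj 𝕜 E (k * l)
  simp only [mul_inv_rev, mul_assoc] at hcomp hmul
  rw [hmul.unique hcomp, ContinuousLinearMap.comp_apply]

theorem lieGroupAd_one (v : E) : lieGroupAd 𝕜 E (1 : G) v = v := by
  have h := hasModelDerivAt_conj 𝕜 E (1 : G)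
  simp only [inv_one, mul_one, one_mul] at h
  rw [h.unique (hasModelDerivAt_id _), ContinuousLinearMap.id_apply]

theorem contMDiff_lieGroupAd :
    ContMDiff 𝓘(𝕜, E) 𝓘(𝕜, E →L[𝕜] E) ∞ (lieGroupAd 𝕜 E : G → E →L[𝕜] E) := fun _ ↦
  contMDiffAt_modelDeriv_of_const (c := 1)
    ((contMDiff_fst.mul contMDiff_snd).mul contMDiff_fst.inv _) (by simp)

end LieGroupDeriv

/-! ### One-parameter subgroups and the Lie bracket -/

theorem t2Space_of_lieGroup (E G : Type*) [NormedAddCommGroup E] [NormedSpace ℝ E] [Group G]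
    [TopologicalSpace G] [ChartedSpace E G] [LieGroup 𝓘(ℝ, E) ∞ G] : T2Space G :=
  have := topologicalGroup_of_lieGroup 𝓘(ℝ, E) ∞ (G := G)
  have := ChartedSpace.t1Space E G
  inferInstance

section OneParameterSubgroup

variable {E : Type*} [NormedAddCommGroup E] [NormedSpace ℝ E]
  {G : Type*} [Group G] [TopologicalSpace G] [ChartedSpace E G]

namespace IsOneParameterSubgroup

variable {γ : ℝ → G} {v : E}

theorem map_zero (h : IsOneParameterSubgroup (E := E) γ v) : γ 0 = 1 := by
  simpa using h.1 0 0

theorem hasVelocityAt_zero (h : IsOneParameterSubgroup (E := E) γ v) : HasVelocityAt γ v 0 := h.2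

theorem comp_mul (h : IsOneParameterSubgroup (E := E) γ v) (c : ℝ) :
    IsOneParameterSubgroup (E := E) (fun t ↦ γ (c * t)) (c • v : E) := by
  refine ⟨fun s t ↦ by simp only [mul_add, h.1], ?_⟩
  refine HasVelocityAt.comp_hasDerivAt ?_ (by simpa using (hasDerivAt_id (0 : ℝ)).const_mul c)
  simpa using h.hasVelocityAt_zero

theorem hasVelocityAt_sub (h : IsOneParameterSubgroup (E := E) γ v) (t : ℝ) :
    HasVelocityAt (fun s ↦ γ (s - t)) v t := by
  have hγ : HasVelocityAt γ v (t - t) := by simpa using h.hasVelocityAt_zero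
  simpa using hγ.comp_hasDerivAt (τ := fun s ↦ s - t) ((hasDerivAt_id t).sub_const t)

theorem hasVelocityAt_mul_inv (h : IsOneParameterSubgroup (E := E) γ v) (t : ℝ) :
    HasVelocityAt (fun s ↦ γ s * (γ t)⁻¹) v t := by
  have hγ (s : ℝ) : γ s * (γ t)⁻¹ = γ (s - t) := by
    rw [mul_inv_eq_iff_eq_mul, ← h.1, sub_add_cancel]
  simpa only [hγ] using h.hasVelocityAt_sub t

end IsOneParameterSubgroup

theorem isMIntegralCurveOn_mulInvariantVectorField_iff {γ : ℝ → G} {v : E} {s : Set ℝ}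
    (hs : IsOpen s) :
    IsMIntegralCurveOn (I := 𝓘(ℝ, E)) γ (mulInvariantVectorField (I := 𝓘(ℝ, E)) (G := G) v) s ↔
      ∀ t ∈ s, HasVelocityAt γ (modelDeriv ℝ E E (fun h : G ↦ γ t * h) 1 v) t :=
  forall₂_congr fun _ ht ↦
    ⟨fun h ↦ h.hasMFDerivAt (hs.mem_nhds ht), fun h ↦ HasMFDerivAt.hasMFDerivWithinAt h⟩

theorem isMIntegralCurve_mulInvariantVectorField_iff {γ : ℝ → G} {v : E} :
    IsMIntegralCurve (I := 𝓘(ℝ, E)) γ (mulInvariantVectorField (I := 𝓘(ℝ, E)) (G := G) v) ↔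
      ∀ t, HasVelocityAt γ (modelDeriv ℝ E E (fun h : G ↦ γ t * h) 1 v) t :=
  Iff.rfl

variable [LieGroup 𝓘(ℝ, E) ∞ G]

theorem modelDeriv_mul_left_mul (a b : G) (v : E) :
    modelDeriv ℝ E E (fun h : G ↦ a * h) b (modelDeriv ℝ E E (fun h : G ↦ b * h) 1 v)
      = modelDeriv ℝ E E (fun h : G ↦ a * b * h) 1 v := by
  have h := (hasModelDerivAt_mul_left ℝ E a b).comp (hasModelDerivAt_mul_left ℝ E b 1) (by simp)
  simp only [← mul_assoc] at h
  rw [h.modelDeriv_eq, ContinuousLinearMap.comp_apply]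

theorem contMDiff_mulInvariantVectorField_one (v : E) :
    ContMDiff 𝓘(ℝ, E) 𝓘(ℝ, E).tangent 1
      (fun g : G ↦ (⟨g, mulInvariantVectorField (I := 𝓘(ℝ, E)) (G := G) v g⟩ :
        TangentBundle 𝓘(ℝ, E) G)) := by
  have : LieGroup 𝓘(ℝ, E) (minSmoothness ℝ 3) G := by
    rw [minSmoothness_of_isRCLikeNormedField]; infer_instance
  refine (contMDiff_mulInvariantVectorField (I := 𝓘(ℝ, E)) (G := G) v).of_le ?_
  rw [minSmoothness_of_isRCLikeNormedField]
  norm_num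

theorem isMIntegralCurveOn_mul_left {γ : ℝ → G} {v : E} {s : Set ℝ} (hs : IsOpen s)
    (h : IsMIntegralCurveOn (I := 𝓘(ℝ, E)) γ
      (mulInvariantVectorField (I := 𝓘(ℝ, E)) (G := G) v) s) (a : G) :
    IsMIntegralCurveOn (I := 𝓘(ℝ, E)) (fun t ↦ a * γ t)
      (mulInvariantVectorField (I := 𝓘(ℝ, E)) (G := G) v) s := by
  refine (isMIntegralCurveOn_mulInvariantVectorField_iff hs).2 fun t ht ↦ ?_
  have hγ := (isMIntegralCurveOn_mulInvariantVectorField_iff hs).1 h t ht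
  have haγ := (hasModelDerivAt_mul_left ℝ E a (γ t)).comp_velocity hγ rfl
  exact modelDeriv_mul_left_mul a (γ t) v ▸ haγ

theorem isMIntegralCurve_mul_left {γ : ℝ → G} {v : E}
    (h : IsMIntegralCurve (I := 𝓘(ℝ, E)) γ (mulInvariantVectorField (I := 𝓘(ℝ, E)) (G := G) v))
    (a : G) : IsMIntegralCurve (I := 𝓘(ℝ, E)) (fun t ↦ a * γ t)
      (mulInvariantVectorField (I := 𝓘(ℝ, E)) (G := G) v) := by
  rw [isMIntegralCurve_iff_isMIntegralCurveOn] at h ⊢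
  exact isMIntegralCurveOn_mul_left isOpen_univ h a

theorem IsOneParameterSubgroup.isMIntegralCurve {γ : ℝ → G} {v : E}
    (h : IsOneParameterSubgroup (E := E) γ v) :
    IsMIntegralCurve (I := 𝓘(ℝ, E)) γ (mulInvariantVectorField (I := 𝓘(ℝ, E)) (G := G) v) := by
  refine isMIntegralCurve_mulInvariantVectorField_iff.2 fun t ↦ ?_
  have hγ := (hasModelDerivAt_mul_left ℝ E (γ t) 1).comp_velocity (h.hasVelocityAt_sub t)
    (by rw [sub_self, h.map_zero])
  simpa only [← h.1, add_sub_cancel] using hγ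

theorem isOneParameterSubgroup_of_isMIntegralCurve {γ : ℝ → G} {v : E}
    (hγ : IsMIntegralCurve (I := 𝓘(ℝ, E)) γ (mulInvariantVectorField (I := 𝓘(ℝ, E)) (G := G) v))
    (h1 : γ 0 = 1) : IsOneParameterSubgroup (E := E) γ v := by
  have := t2Space_of_lieGroup E G
  constructor
  · intro s t
    have hγs : γ ∘ (· + s) = fun t ↦ γ s * γ t :=
      isMIntegralCurve_Ioo_eq_of_contMDiff_boundaryless (t₀ := 0)
        (contMDiff_mulInvariantVectorField_one v) (hγ.comp_add s)
        (isMIntegralCurve_mul_left hγ (γ s)) (by simp [h1])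
    rw [add_comm]
    exact congrFun hγs t
  · have hγ0 := isMIntegralCurve_mulInvariantVectorField_iff.1 hγ 0
    have hv : modelDeriv ℝ E E (fun h : G ↦ γ 0 * h) 1 v = v := by
      simp only [h1, one_mul, (hasModelDerivAt_id (1 : G)).modelDeriv_eq,
        ContinuousLinearMap.id_apply]
    exact hv ▸ hγ0

theorem exists_isOneParameterSubgroup [CompleteSpace E] (v : E) :
    ∃ γ : ℝ → G, IsOneParameterSubgroup (E := E) γ v := by
  have := t2Space_of_lieGroup E G
  have hV := contMDiff_mulInvariantVectorField_one (G := G) v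
  obtain ⟨γ₀, hγ₀1, hγ₀⟩ := exists_isMIntegralCurveAt_of_contMDiffAt_boundaryless (t₀ := 0)
    (hV.contMDiffAt (x := (1 : G)))
  obtain ⟨ε, hε, hγ₀⟩ := isMIntegralCurveAt_iff'.1 hγ₀
  rw [Real.ball_eq_Ioo, zero_sub, zero_add] at hγ₀
  -- Left translates of `γ₀` live for the same time `ε`, so integral curves never stop.
  obtain ⟨γ, hγ1, hγ⟩ := exists_isMIntegralCurve_of_isMIntegralCurveOn hV hε
    (fun x ↦ ⟨fun t ↦ x * γ₀ t, by simp [hγ₀1], isMIntegralCurveOn_mul_left isOpen_Ioo hγ₀ x⟩)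
    (1 : G)
  exact ⟨γ, isOneParameterSubgroup_of_isMIntegralCurve hγ hγ1⟩

theorem IsOneParameterSubgroup.unique {γ γ' : ℝ → G} {v : E}
    (h : IsOneParameterSubgroup (E := E) γ v) (h' : IsOneParameterSubgroup (E := E) γ' v) :
    γ = γ' :=
  have := t2Space_of_lieGroup E G
  isMIntegralCurve_Ioo_eq_of_contMDiff_boundaryless (t₀ := 0)
    (contMDiff_mulInvariantVectorField_one v) h.isMIntegralCurve h'.isMIntegralCurve
    (h.map_zero.trans h'.map_zero.symm)

theorem IsOneParameterSubgroup.lieExp_eq {γ : ℝ → G} {v : E}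
    (h : IsOneParameterSubgroup (E := E) γ v) : lieExp (E := E) (G := G) v = γ 1 := by
  have hex : ∃ γ : ℝ → G, IsOneParameterSubgroup (E := E) γ v := ⟨γ, h⟩
  rw [show lieExp (E := E) (G := G) v = hex.choose 1 from dif_pos hex, hex.choose_spec.unique h]

theorem isOneParameterSubgroup_lieExp [CompleteSpace E] (v : E) :
    IsOneParameterSubgroup (E := E) (fun t : ℝ ↦ lieExp (E := E) (G := G) (t • v : E)) v := by
  obtain ⟨γ, h⟩ := exists_isOneParameterSubgroup (G := G) v
  have hγ : (fun t : ℝ ↦ lieExp (E := E) (G := G) (t • v : E)) = γ := by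
    funext t
    rw [(h.comp_mul t).lieExp_eq, mul_one]
  exact hγ ▸ h

theorem lieExp_zero [CompleteSpace E] : lieExp (E := E) (G := G) (0 : E) = 1 := by
  simpa using (isOneParameterSubgroup_lieExp (G := G) (0 : E)).map_zero

theorem IsOneParameterSubgroup.conj {γ : ℝ → G} {v : E}
    (h : IsOneParameterSubgroup (E := E) γ v) (a : G) :
    IsOneParameterSubgroup (E := E) (fun t ↦ a * γ t * a⁻¹) (lieGroupAd ℝ E a v) :=
  ⟨fun s t ↦ by simp only [h.1]; group,
    (hasModelDerivAt_conj ℝ E a).comp_velocity h.hasVelocityAt_zero h.map_zero⟩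

theorem conj_lieExp [CompleteSpace E] (a : G) (v : E) :
    a * lieExp (E := E) (G := G) v * a⁻¹ = lieExp (E := E) (G := G) (lieGroupAd ℝ E a v) := by
  rw [((isOneParameterSubgroup_lieExp (G := G) v).conj a).lieExp_eq, one_smul]

theorem IsOneParameterSubgroup.lieGroupAd_self {γ : ℝ → G} {v : E}
    (h : IsOneParameterSubgroup (E := E) γ v) (t : ℝ) : lieGroupAd ℝ E (γ t) v = v := by
  have hconj : (fun s ↦ γ t * γ s * (γ t)⁻¹) = γ := by
    funext s
    rw [← h.1, add_comm, h.1, mul_inv_cancel_right]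
  have hv := (h.conj (γ t)).hasVelocityAt_zero
  rw [hconj] at hv
  exact hv.unique h.hasVelocityAt_zero

end OneParameterSubgroup

section Bracket

variable {𝕜 : Type*} [NontriviallyNormedField 𝕜]
  {E : Type*} [NormedAddCommGroup E] [NormedSpace 𝕜 E]
  {G : Type*} [Group G] [TopologicalSpace G] [ChartedSpace E G] [LieGroup 𝓘(𝕜, E) ∞ G]

variable (𝕜 E G) in
/-- The Lie bracket `[u, v]`, as the derivative `ad` of the adjoint action at `1`. -/
def lieGroupBracket : E →L[𝕜] E →L[𝕜] E := modelDeriv 𝕜 E (E →L[𝕜] E) (lieGroupAd 𝕜 E) (1 : G)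

theorem hasModelDerivAt_lieGroupAd :
    HasModelDerivAt 𝕜 (lieGroupAd 𝕜 E) (1 : G) (lieGroupBracket 𝕜 E G) :=
  hasModelDerivAt_modelDeriv ((contMDiff_lieGroupAd 𝕜 E).mdifferentiable (by simp) 1)

theorem hasModelDerivAt_lieGroupAd_apply (v : E) :
    HasModelDerivAt 𝕜 (fun k : G ↦ lieGroupAd 𝕜 E k v) 1 ((lieGroupBracket 𝕜 E G).flip v) :=
  (hasModelDerivAt_iff_hasFDerivAt.2 (ContinuousLinearMap.apply 𝕜 E v).hasFDerivAt).comp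
    hasModelDerivAt_lieGroupAd rfl

theorem hasDerivAt_lieGroupAd {γ : 𝕜 → G} {u : E} {t : 𝕜}
    (h : HasVelocityAt (fun s ↦ γ s * (γ t)⁻¹) u t) (v : E) :
    HasDerivAt (fun s ↦ lieGroupAd 𝕜 E (γ s) v)
      (lieGroupBracket 𝕜 E G u (lieGroupAd 𝕜 E (γ t) v)) t := by
  have hAd := (hasModelDerivAt_lieGroupAd_apply (lieGroupAd 𝕜 E (γ t) v)).comp_velocity h
    (mul_inv_cancel _)
  simpa only [← lieGroupAd_mul, inv_mul_cancel_right, ContinuousLinearMap.flip_apply]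
    using hasVelocityAt_iff_hasDerivAt.1 hAd

end Bracket

section ComplexLieGroup

variable {EK : Type*} [NormedAddCommGroup EK] [NormedSpace ℂ EK]
  {K : Type*} [Group K] [TopologicalSpace K] [ChartedSpace EK K] [LieGroup 𝓘(ℂ, EK) ω K]

theorem lieGroupAd_real_eq (k : K) (v : EK) : lieGroupAd ℝ EK k v = lieGroupAd ℂ EK k v := by
  have h := (hasModelDerivAt_conj ℂ EK k).restrictScalars_real
  rw [(hasModelDerivAt_conj ℝ EK k).unique h, ContinuousLinearMap.coe_restrictScalars']

theorem lieGroupAd_real_smul (k : K) (c : ℂ) (v : EK) :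
    lieGroupAd ℝ EK k (c • v) = c • lieGroupAd ℝ EK k v := by
  simp only [lieGroupAd_real_eq, map_smul]

theorem lieGroupBracket_real_eq (u v : EK) :
    lieGroupBracket ℝ EK K u v = lieGroupBracket ℂ EK K u v := by
  have h := (hasModelDerivAt_lieGroupAd_apply (𝕜 := ℂ) (G := K) v).restrictScalars_real
  simp only [← lieGroupAd_real_eq] at h
  exact DFunLike.congr_fun ((hasModelDerivAt_lieGroupAd_apply (𝕜 := ℝ) (G := K) v).unique h) u

theorem lieGroupBracket_real_smul_left (c : ℂ) (u v : EK) :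
    lieGroupBracket ℝ EK K (c • u) v = c • lieGroupBracket ℝ EK K u v := by
  simp only [lieGroupBracket_real_eq, map_smul, smul_apply]

theorem lieGroupBracket_real_smul_right (c : ℂ) (u v : EK) :
    lieGroupBracket ℝ EK K u (c • v) = c • lieGroupBracket ℝ EK K u v := by
  simp only [lieGroupBracket_real_eq, map_smul]

end ComplexLieGroup

/-! ### Polar decomposition -/

section Complexification

variable {EL : Type*} [NormedAddCommGroup EL] [NormedSpace ℝ EL]
  {EK : Type*} [NormedAddCommGroup EK] [NormedSpace ℂ EK]
  {L : Type*} [Group L] [TopologicalSpace L] [ChartedSpace EL L]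
  {K : Type*} [Group K] [TopologicalSpace K] [ChartedSpace EK K]

variable (EL EK) in
/-- `lieMap` as a continuous linear map between the model spaces. -/
def lieMapL (ι : L →* K) : EL →L[ℝ] EK := modelDeriv ℝ EL EK (ι : L → K) 1

variable (EL EK) in
/-- `complexLie`, that is `(a, b) ↦ a + √-1 b`, as a continuous linear map. -/
def complexLieL (ι : L →* K) : EL × EL →L[ℝ] EK :=
  (lieMapL EL EK ι).coprod (Complex.I • lieMapL EL EK ι)

variable (EL EK) in
/-- The map `ξ ↦ e^{√-1 ξ}`, as a map on the model space. -/
def polarExp (ι : L →* K) (ξ : EL) : K :=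
  lieExp (E := EK) (G := K) (Complex.I • lieMapL EL EK ι ξ : EK)

theorem expI_eq_polarExp (ι : L →* K) (ξ : EL) :
    expI (EL := EL) (EK := EK) ι ξ = polarExp EL EK ι ξ := by
  have h : (complexLie (EL := EL) (EK := EK) ι 0 ξ : EK) = Complex.I • lieMapL EL EK ι ξ := by
    change lieMapL EL EK ι 0 + Complex.I • lieMapL EL EK ι ξ = _
    rw [map_zero, zero_add]
  exact congrArg (lieExp (E := EK) (G := K)) h

namespace IsComplexification

variable {ι : L →* K} (hι : IsComplexification (EL := EL) (EK := EK) ι)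

section LieAlgebra

include hι

theorem bijective_complexLieL : Function.Bijective (complexLieL EL EK ι) :=
  (Function.bijective_iff_existsUnique _).2 hι.lieAlgebra

theorem hasModelDerivAt_one : HasModelDerivAt ℝ (ι : L → K) 1 (lieMapL EL EK ι) :=
  hasModelDerivAt_modelDeriv (hι.contMDiff.mdifferentiable (by simp) 1)

end LieAlgebra

section FiniteDimensional

variable [FiniteDimensional ℝ EL]

/-- The decomposition `𝔩 ⊕ √-1 𝔩` of the Lie algebra of the complexification. -/
def decomp : (EL × EL) ≃L[ℝ] EK :=
  let e := LinearEquiv.ofBijective (complexLieL EL EK ι).toLinearMap hι.bijective_complexLieL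
  haveI : FiniteDimensional ℝ EK := e.finiteDimensional
  e.toContinuousLinearEquiv

/-- The projection `a + √-1 b ↦ a`. -/
def re : EK →L[ℝ] EL := (ContinuousLinearMap.fst ℝ EL EL).comp (hι.decomp.symm : EK →L[ℝ] EL × EL)

/-- The projection `a + √-1 b ↦ b`. -/
def im : EK →L[ℝ] EL := (ContinuousLinearMap.snd ℝ EL EL).comp (hι.decomp.symm : EK →L[ℝ] EL × EL)

theorem re_add_im (u : EK) :
    lieMapL EL EK ι (hι.re u) + Complex.I • lieMapL EL EK ι (hι.im u) = u :=
  hι.decomp.apply_symm_apply u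

theorem im_add_I_smul (a b : EL) :
    hι.im (lieMapL EL EK ι a + Complex.I • lieMapL EL EK ι b) = b :=
  congrArg Prod.snd (hι.decomp.symm_apply_apply (a, b))

theorem im_lieMapL (a : EL) : hι.im (lieMapL EL EK ι a) = 0 := by
  simpa using hι.im_add_I_smul a 0

theorem im_I_smul_lieMapL (b : EL) : hι.im (Complex.I • lieMapL EL EK ι b) = b := by
  simpa using hι.im_add_I_smul 0 b

include hι in
theorem completeSpace : CompleteSpace EK :=
  (completeSpace_congr (e := hι.decomp.toEquiv) hι.decomp.isUniformEmbedding).1 inferInstance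

end FiniteDimensional

include hι in
theorem exists_polarDiffeo : ∃ D : Diffeomorph (𝓘(ℝ, EL).prod 𝓘(ℝ, EL)) 𝓘(ℝ, EK) (L × EL) K ∞,
    ∀ (a : L) (ξ : EL), D (a, ξ) = ι a * polarExp EL EK ι ξ := by
  simpa only [expI_eq_polarExp] using hι.polar

/-- The polar decomposition `L × 𝔩 ≃ K`, `(a, ξ) ↦ a e^{√-1 ξ}`. -/
def polarDiffeo : Diffeomorph (𝓘(ℝ, EL).prod 𝓘(ℝ, EL)) 𝓘(ℝ, EK) (L × EL) K ∞ :=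
  hι.exists_polarDiffeo.choose

theorem polarDiffeo_apply (a : L) (ξ : EL) :
    hι.polarDiffeo (a, ξ) = ι a * polarExp EL EK ι ξ :=
  hι.exists_polarDiffeo.choose_spec a ξ

/-- The component `a` of `a e^{√-1 ξ}`. -/
def polarL (k : K) : L := (hι.polarDiffeo.symm k).1

/-- The component `ξ` of `a e^{√-1 ξ}`. It identifies `L \ L^ℂ` with `𝔩`. -/
def polarLog (k : K) : EL := (hι.polarDiffeo.symm k).2

theorem map_polarL_mul_polarExp_polarLog (k : K) :
    ι (hι.polarL k) * polarExp EL EK ι (hι.polarLog k) = k := by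
  rw [← hι.polarDiffeo_apply]
  exact hι.polarDiffeo.apply_symm_apply k

theorem polarLog_map_mul_polarExp (a : L) (ξ : EL) :
    hι.polarLog (ι a * polarExp EL EK ι ξ) = ξ := by
  rw [← hι.polarDiffeo_apply, polarLog, hι.polarDiffeo.symm_apply_apply]

theorem polarL_map_mul_polarExp (a : L) (ξ : EL) :
    hι.polarL (ι a * polarExp EL EK ι ξ) = a := by
  rw [← hι.polarDiffeo_apply, polarL, hι.polarDiffeo.symm_apply_apply]

theorem polarLog_polarExp (ξ : EL) : hι.polarLog (polarExp EL EK ι ξ) = ξ := by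
  simpa using hι.polarLog_map_mul_polarExp 1 ξ

theorem polarL_polarExp (ξ : EL) : hι.polarL (polarExp EL EK ι ξ) = 1 := by
  simpa using hι.polarL_map_mul_polarExp 1 ξ

theorem polarLog_map_mul (a : L) (k : K) : hι.polarLog (ι a * k) = hι.polarLog k := by
  conv_lhs => rw [← hι.map_polarL_mul_polarExp_polarLog k, ← mul_assoc, ← map_mul,
    hι.polarLog_map_mul_polarExp]

theorem contMDiff_polarL : ContMDiff 𝓘(ℝ, EK) 𝓘(ℝ, EL) ∞ hι.polarL :=
  contMDiff_fst.comp hι.polarDiffeo.symm.contMDiff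

theorem contMDiff_polarLog : ContMDiff 𝓘(ℝ, EK) 𝓘(ℝ, EL) ∞ hι.polarLog :=
  contMDiff_snd.comp hι.polarDiffeo.symm.contMDiff

include hι in
theorem contMDiff_polarExp : ContMDiff 𝓘(ℝ, EL) 𝓘(ℝ, EK) ∞ (polarExp EL EK ι) := by
  have h := hι.polarDiffeo.contMDiff.comp (contMDiff_const (c := (1 : L)).prodMk
    (contMDiff_id (I := 𝓘(ℝ, EL)) (M := EL) (n := ∞)))
  convert h using 1
  funext ξ
  simp [hι.polarDiffeo_apply]

end IsComplexification

end Complexification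

theorem hasDerivAt_smul_id {E : Type*} [NormedAddCommGroup E] [NormedSpace ℝ E] (v : E) (t : ℝ) :
    HasDerivAt (fun s : ℝ ↦ s • v) v t := by
  simpa using (hasDerivAt_id t).smul_const v

section PolarExp

variable {EL : Type*} [NormedAddCommGroup EL] [NormedSpace ℝ EL]
  {EK : Type*} [NormedAddCommGroup EK] [NormedSpace ℂ EK] [CompleteSpace EK]
  {L : Type*} [Group L] [TopologicalSpace L] [ChartedSpace EL L]
  {K : Type*} [Group K] [TopologicalSpace K] [ChartedSpace EK K] [LieGroup 𝓘(ℂ, EK) ω K]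
  (ι : L →* K)

theorem isOneParameterSubgroup_polarExp (ξ : EL) :
    IsOneParameterSubgroup (E := EK) (fun t : ℝ ↦ polarExp EL EK ι (t • ξ))
      (Complex.I • lieMapL EL EK ι ξ : EK) := by
  have h := isOneParameterSubgroup_lieExp (G := K) (Complex.I • lieMapL EL EK ι ξ : EK)
  simpa only [polarExp, map_smul, smul_comm Complex.I] using h

theorem polarExp_zero : polarExp EL EK ι 0 = 1 := by
  simpa using (isOneParameterSubgroup_polarExp (EL := EL) ι 0).map_zero

theorem polarExp_add_smul (s t : ℝ) (ξ : EL) :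
    polarExp EL EK ι ((s + t) • ξ) = polarExp EL EK ι (s • ξ) * polarExp EL EK ι (t • ξ) :=
  (isOneParameterSubgroup_polarExp ι ξ).1 s t

theorem hasDerivAt_lieGroupAd_polarExp (ξ : EL) (u : EK) (t : ℝ) :
    HasDerivAt (fun s : ℝ ↦ lieGroupAd ℝ EK (polarExp EL EK ι (s • ξ)) u)
      (lieGroupBracket ℝ EK K (Complex.I • lieMapL EL EK ι ξ)
        (lieGroupAd ℝ EK (polarExp EL EK ι (t • ξ)) u)) t :=
  hasDerivAt_lieGroupAd ((isOneParameterSubgroup_polarExp ι ξ).hasVelocityAt_mul_inv t) u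

variable (EL EK) in
/-- The right logarithmic derivative at `ξ` of the map `ξ ↦ e^{√-1 ξ}`. -/
def polarLogDeriv (ξ : EL) : EL →L[ℝ] EK :=
  modelDeriv ℝ EL EK (fun η ↦ polarExp EL EK ι (ξ + η) * (polarExp EL EK ι ξ)⁻¹) 0

end PolarExp

namespace IsComplexification

variable {EL : Type*} [NormedAddCommGroup EL] [NormedSpace ℝ EL]
  {EK : Type*} [NormedAddCommGroup EK] [NormedSpace ℂ EK]
  {L : Type*} [Group L] [TopologicalSpace L] [ChartedSpace EL L] [LieGroup 𝓘(ℝ, EL) ∞ L]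
  {K : Type*} [Group K] [TopologicalSpace K] [ChartedSpace EK K] [LieGroup 𝓘(ℂ, EK) ω K]
  {ι : L →* K} (hι : IsComplexification (EL := EL) (EK := EK) ι)

include hι

theorem lieGroupAd_lieMapL (a : L) (ξ : EL) :
    lieGroupAd ℝ EK (ι a) (lieMapL EL EK ι ξ) = lieMapL EL EK ι (lieGroupAd ℝ EL a ξ) := by
  have hK := (hasModelDerivAt_conj ℝ EK (ι a)).comp hι.hasModelDerivAt_one (map_one ι)
  have hL := hι.hasModelDerivAt_one.comp (hasModelDerivAt_conj ℝ EL a) (by simp)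
  simp only [map_mul, map_inv] at hL
  exact DFunLike.congr_fun (hK.unique hL) ξ

theorem lieGroupBracket_lieMapL (ξ η : EL) :
    lieGroupBracket ℝ EK K (lieMapL EL EK ι ξ) (lieMapL EL EK ι η)
      = lieMapL EL EK ι (lieGroupBracket ℝ EL L ξ η) := by
  have hK := (hasModelDerivAt_lieGroupAd_apply (𝕜 := ℝ) (G := K) (lieMapL EL EK ι η)).comp
    hι.hasModelDerivAt_one (map_one ι)
  simp only [hι.lieGroupAd_lieMapL] at hK
  have hL := (hasModelDerivAt_iff_hasFDerivAt.2 (lieMapL EL EK ι).hasFDerivAt).comp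
    (hasModelDerivAt_lieGroupAd_apply (𝕜 := ℝ) (G := L) η) rfl
  exact DFunLike.congr_fun (hK.unique hL) ξ

theorem im_lieGroupBracket_I_smul [FiniteDimensional ℝ EL] (ξ : EL) (u : EK) :
    hι.im (lieGroupBracket ℝ EK K (Complex.I • lieMapL EL EK ι ξ) u)
      = lieGroupBracket ℝ EL L ξ (hι.re u) := by
  conv_lhs => rw [← hι.re_add_im u]
  rw [lieGroupBracket_real_smul_left, map_add, lieGroupBracket_real_smul_right,
    hι.lieGroupBracket_lieMapL, hι.lieGroupBracket_lieMapL, smul_add, smul_smul, Complex.I_mul_I,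
    neg_one_smul, ← map_neg, add_comm, hι.im_add_I_smul]

theorem conj_polarExp [CompleteSpace EK] (a : L) (ξ : EL) :
    ι a * polarExp EL EK ι ξ * (ι a)⁻¹ = polarExp EL EK ι (lieGroupAd ℝ EL a ξ) := by
  rw [polarExp, conj_lieExp, polarExp, lieGroupAd_real_smul, hι.lieGroupAd_lieMapL]

end IsComplexification

namespace IsComplexification

variable {EL : Type*} [NormedAddCommGroup EL] [NormedSpace ℝ EL]
  {EK : Type*} [NormedAddCommGroup EK] [NormedSpace ℂ EK]
  {L : Type*} [Group L] [TopologicalSpace L] [ChartedSpace EL L]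
  {K : Type*} [Group K] [TopologicalSpace K] [ChartedSpace EK K] [LieGroup 𝓘(ℂ, EK) ω K]
  {ι : L →* K} (hι : IsComplexification (EL := EL) (EK := EK) ι)

include hι

theorem hasModelDerivAt_polarExp_mul_inv (ξ : EL) :
    HasModelDerivAt ℝ (fun η ↦ polarExp EL EK ι η * (polarExp EL EK ι ξ)⁻¹) ξ
      (polarLogDeriv EL EK ι ξ) := by
  have hη : HasModelDerivAt ℝ (fun η : EL ↦ η - ξ) ξ (ContinuousLinearMap.id ℝ EL) :=
    hasModelDerivAt_iff_hasFDerivAt.2 ((hasFDerivAt_id ξ).sub_const ξ)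
  have hexp : HasModelDerivAt ℝ (fun η ↦ polarExp EL EK ι (ξ + η) * (polarExp EL EK ι ξ)⁻¹) 0
      (polarLogDeriv EL EK ι ξ) := by
    refine hasModelDerivAt_modelDeriv (ContMDiff.mdifferentiable (n := ∞) ?_ (by simp) 0)
    exact (hι.contMDiff_polarExp.comp (contDiff_const.add contDiff_id).contMDiff).mul
      contMDiff_const
  simpa only [add_sub_cancel, ContinuousLinearMap.comp_id] using hexp.comp hη (sub_self ξ)

theorem contDiff_polarLogDeriv : ContDiff ℝ ∞ (polarLogDeriv EL EK ι) := by
  rw [← contMDiff_iff_contDiff]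
  refine fun ξ ↦ contMDiffAt_modelDeriv_of_const (c := 1) ?_ (by simp)
  have hadd : ContMDiff (𝓘(ℝ, EL).prod 𝓘(ℝ, EL)) 𝓘(ℝ, EK) ∞
      (fun p : EL × EL ↦ polarExp EL EK ι (p.1 + p.2)) :=
    hι.contMDiff_polarExp.comp (contMDiff_fst.add contMDiff_snd)
  exact (hadd.mul (hι.contMDiff_polarExp.comp contMDiff_fst).inv) _

variable [CompleteSpace EK]

theorem polarLogDeriv_zero (η : EL) :
    polarLogDeriv EL EK ι 0 η = Complex.I • lieMapL EL EK ι η := by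
  have h := hι.hasModelDerivAt_polarExp_mul_inv 0
  simp only [polarExp_zero, inv_one, mul_one] at h
  exact HasVelocityAt.unique (h.comp_velocity (hasVelocityAt_iff_hasDerivAt.2
    (hasDerivAt_smul_id η 0)) (zero_smul _ _))
    (isOneParameterSubgroup_polarExp ι η).hasVelocityAt_zero

theorem polarLogDeriv_add_smul (s t : ℝ) (ξ η : EL) :
    polarLogDeriv EL EK ι ((s + t) • ξ) ((s + t) • η)
      = polarLogDeriv EL EK ι (s • ξ) (s • η)
        + lieGroupAd ℝ EK (polarExp EL EK ι (s • ξ)) (polarLogDeriv EL EK ι (t • ξ) (t • η)) := by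
  have hscale (c : ℝ) : HasModelDerivAt ℝ
      (fun z ↦ polarExp EL EK ι (c • z) * (polarExp EL EK ι (c • ξ))⁻¹) ξ
      ((polarLogDeriv EL EK ι (c • ξ)).comp (c • ContinuousLinearMap.id ℝ EL)) :=
    (hι.hasModelDerivAt_polarExp_mul_inv (c • ξ)).comp
      (hasModelDerivAt_iff_hasFDerivAt.2 ((hasFDerivAt_id ξ).const_smul c)) rfl
  have hconj := (hasModelDerivAt_conj ℝ EK (polarExp EL EK ι (s • ξ))).comp (hscale t) (by simp)
  have hmul := (hscale s).mul_of_eq_one hconj (by simp) (by simp)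
  have hadd := hmul.congr (g := fun z ↦ polarExp EL EK ι ((s + t) • z)
    * (polarExp EL EK ι ((s + t) • ξ))⁻¹) (.of_forall fun z ↦ by
      rw [polarExp_add_smul, polarExp_add_smul]; group)
  simpa using DFunLike.congr_fun ((hscale (s + t)).unique hadd) η

theorem hasDerivAt_polarLogDeriv_smul (ξ η : EL) (t : ℝ) :
    HasDerivAt (fun s : ℝ ↦ polarLogDeriv EL EK ι (s • ξ) (s • η))
      (lieGroupAd ℝ EK (polarExp EL EK ι (t • ξ)) (Complex.I • lieMapL EL EK ι η)) t := by
  have hzero : HasDerivAt (fun s : ℝ ↦ polarLogDeriv EL EK ι (s • ξ) (s • η))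
      (Complex.I • lieMapL EL EK ι η) (t - t) := by
    have hdiff : ContDiff ℝ ∞ (fun s : ℝ ↦ polarLogDeriv EL EK ι (s • ξ) η) := by
      have := hι.contDiff_polarLogDeriv
      fun_prop
    simpa [hι.polarLogDeriv_zero, Pi.smul_def'] using
      (hasDerivAt_id (0 : ℝ)).smul ((hdiff.differentiable (by simp)) 0).hasDerivAt
  have hshift := HasDerivAt.scomp (h := fun s : ℝ ↦ s - t) t hzero ((hasDerivAt_id t).sub_const t)
  have hAd := ((lieGroupAd ℝ EK (polarExp EL EK ι (t • ξ))).hasFDerivAt.comp_hasDerivAt t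
    hshift).const_add (polarLogDeriv EL EK ι (t • ξ) (t • η))
  rw [one_smul] at hAd
  refine hAd.congr_of_eventuallyEq (.of_forall fun s ↦ ?_)
  simpa using hι.polarLogDeriv_add_smul t (s - t) ξ η

/-- Both sides vanish at `t = 0` and have the same derivative in `t`. -/
theorem lieGroupAd_polarExp_sub (ξ η : EL) (t : ℝ) :
    lieGroupAd ℝ EK (polarExp EL EK ι (t • ξ)) (Complex.I • lieMapL EL EK ι η)
        - Complex.I • lieMapL EL EK ι η
      = lieGroupBracket ℝ EK K (Complex.I • lieMapL EL EK ι ξ)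
          (polarLogDeriv EL EK ι (t • ξ) (t • η)) := by
  have hdiff (s : ℝ) := (hasDerivAt_lieGroupAd_polarExp ι ξ (Complex.I • lieMapL EL EK ι η) s).sub
    ((lieGroupBracket ℝ EK K (Complex.I • lieMapL EL EK ι ξ)).hasFDerivAt.comp_hasDerivAt s
      (hι.hasDerivAt_polarLogDeriv_smul ξ η s))
  have hconst := is_const_of_deriv_eq_zero (fun s ↦ (hdiff s).differentiableAt)
    (fun s ↦ (hdiff s).deriv.trans (sub_self _)) t 0
  simp only [Pi.sub_apply, Function.comp_apply, zero_smul, map_zero, sub_zero, polarExp_zero,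
    lieGroupAd_one] at hconst
  exact sub_eq_iff_eq_add'.2 (sub_eq_iff_eq_add.1 hconst)

end IsComplexification

section ParametricIntegral

variable {E : Type*} [NormedAddCommGroup E] [NormedSpace ℝ E]
  {F : Type*} [NormedAddCommGroup F] [NormedSpace ℝ F]

theorem continuous_fderiv_left_of_contDiff {f : E → ℝ → F}
    (hf : ContDiff ℝ 1 (Function.uncurry f)) :
    Continuous fun p : E × ℝ ↦ fderiv ℝ (fun x ↦ f x p.2) p.1 :=
  (ContDiff.fderiv (f := fun (p : E × ℝ) x ↦ f x p.2) (n := 0) (m := 1)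
    (hf.comp (contDiff_snd.prodMk (contDiff_snd.comp contDiff_fst))) contDiff_fst
    (by simp)).continuous

theorem hasFDerivAt_intervalIntegral_of_contDiff [ProperSpace E] {f : E → ℝ → F}
    (hf : ContDiff ℝ 1 (Function.uncurry f)) (a b : ℝ) (x₀ : E) :
    HasFDerivAt (fun x ↦ ∫ t in a..b, f x t) (∫ t in a..b, fderiv ℝ (fun x ↦ f x t) x₀) x₀ := by
  have hf' := continuous_fderiv_left_of_contDiff hf
  have hcont (x : E) : Continuous (f x) :=
    hf.continuous.comp (continuous_const.prodMk continuous_id)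
  have hdiff (t : ℝ) : Differentiable ℝ fun x ↦ f x t :=
    (hf.comp (contDiff_id.prodMk contDiff_const)).differentiable (by simp)
  obtain ⟨C, hC⟩ := ((isCompact_closedBall x₀ 1).prod
    (isCompact_uIcc (a := a) (b := b))).exists_bound_of_continuousOn hf'.continuousOn
  exact intervalIntegral.hasFDerivAt_integral_of_dominated_of_fderiv_le
    (F' := fun x t ↦ fderiv ℝ (fun x ↦ f x t) x) (bound := fun _ ↦ C)
    (Metric.ball_mem_nhds x₀ one_pos)
    (.of_forall fun x ↦ (hcont x).aestronglyMeasurable)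
    ((hcont x₀).intervalIntegrable _ _)
    (hf'.comp (continuous_const.prodMk continuous_id)).aestronglyMeasurable
    (.of_forall fun t ht x hx ↦
      hC (x, t) ⟨Metric.ball_subset_closedBall hx, uIoc_subset_uIcc ht⟩)
    intervalIntegrable_const
    (.of_forall fun t _ x _ ↦ (hdiff t x).hasFDerivAt)

/-- A radial Poincaré lemma: after an integration by parts along the ray, only boundary terms
remain. -/
theorem hasFDerivAt_radialIntegral [ProperSpace E] [CompleteSpace F] {α : E → E →L[ℝ] F}
    (hα : ContDiff ℝ 1 α) {x : E} {G : E → ℝ → F} {φ : E →L[ℝ] F}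
    (hG : ∀ η s, HasDerivAt (G η) (fderiv ℝ α (s • x) (s • η) x + α (s • x) η) s)
    (hφ : ∀ η, G η 1 - G η 0 = φ η) :
    HasFDerivAt (fun y ↦ ∫ s in (0 : ℝ)..1, α (s • y) y) φ x := by
  have hf : ContDiff ℝ 1 (Function.uncurry fun (y : E) (s : ℝ) ↦ α (s • y) y) := by
    simp only [Function.uncurry_def]
    fun_prop
  have hcont : Continuous fun s : ℝ ↦ fderiv ℝ (fun y ↦ α (s • y) y) x :=
    (continuous_fderiv_left_of_contDiff hf).comp (continuous_const.prodMk continuous_id)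
  have happly (s : ℝ) (η : E) : fderiv ℝ (fun y ↦ α (s • y) y) x η
      = fderiv ℝ α (s • x) (s • η) x + α (s • x) η := by
    have hs := ((hα.differentiable (by simp) (s • x)).hasFDerivAt.comp x
      ((hasFDerivAt_id x).const_smul s)).clm_apply (hasFDerivAt_id x)
    refine (DFunLike.congr_fun hs.fderiv η).trans ?_
    simp [add_comm]
  convert! hasFDerivAt_intervalIntegral_of_contDiff hf 0 1 x using 1
  ext η
  rw [ContinuousLinearMap.intervalIntegral_apply (hcont.intervalIntegrable _ _), ← hφ η]
  simp only [happly]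
  refine (intervalIntegral.integral_eq_sub_of_hasDerivAt (fun s _ ↦ hG η s) ?_).symm
  simp only [← happly]
  exact (hcont.clm_apply continuous_const).intervalIntegrable _ _

end ParametricIntegral

/-! ### Moment maps -/

section Action

variable {EK : Type*} [NormedAddCommGroup EK] [NormedSpace ℂ EK]
  {EX : Type*} [NormedAddCommGroup EX] [NormedSpace ℂ EX]
  {K : Type*} [Group K] [TopologicalSpace K] [ChartedSpace EK K]
  {X : Type*} [TopologicalSpace X] [ChartedSpace EX X]
  [MulAction K X] [ContMDiffSMul 𝓘(ℂ, EK) 𝓘(ℂ, EX) ω K X]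

variable (EK EX K) in
/-- The infinitesimal action at `x`: the derivative at `1` of the orbit map `k ↦ k x`. -/
def actionDeriv (x : X) : EK →L[ℂ] EX := modelDeriv ℂ EK EX (fun k : K ↦ k • x) 1

theorem contMDiff_smul_point (x : X) :
    ContMDiff 𝓘(ℂ, EK) 𝓘(ℂ, EX) ω (fun k : K ↦ k • x) :=
  contMDiff_id.smul contMDiff_const

theorem hasModelDerivAt_smul_point (x : X) :
    HasModelDerivAt ℝ (fun k : K ↦ k • x) 1 ((actionDeriv EK EX K x).restrictScalars ℝ) :=
  (hasModelDerivAt_modelDeriv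
    ((contMDiff_smul_point x).mdifferentiable (by simp) 1)).restrictScalars_real

theorem IsComplexification.fundamentalVector_eq
    {EL : Type*} [NormedAddCommGroup EL] [NormedSpace ℝ EL]
    {L : Type*} [Group L] [TopologicalSpace L] [ChartedSpace EL L]
    {ι : L →* K} (hι : IsComplexification (EL := EL) (EK := EK) ι) (x : X) (ξ : EL) :
    fundamentalVector (EL := EL) (EX := EX) ι ξ x = actionDeriv EK EX K x (lieMapL EL EK ι ξ) :=
  have horbit := (hasModelDerivAt_smul_point (EK := EK) (EX := EX) (K := K) x).comp
    hι.hasModelDerivAt_one (map_one ι)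
  DFunLike.congr_fun horbit.modelDeriv_eq ξ

end Action

section OrbitForm

variable {EK : Type*} [NormedAddCommGroup EK] [NormedSpace ℂ EK]
  {EX : Type*} [NormedAddCommGroup EX] [NormedSpace ℂ EX]
  {K : Type*} [Group K] [TopologicalSpace K] [ChartedSpace EK K]
  {X : Type*} [TopologicalSpace X] [ChartedSpace EX X] [IsManifold 𝓘(ℂ, EX) ω X] [MulAction K X]
  (g : Bundle.ContMDiffRiemannianMetric 𝓘(ℝ, EX) ∞ EX (fun x : X ↦ TangentSpace 𝓘(ℝ, EX) x))

/-- The Riemannian metric at `x`, as a bilinear form on the model space. -/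
def modelInner (x : X) : EX →L[ℝ] EX →L[ℝ] ℝ := g.inner x

variable (EK K) in
/-- The pullback to the Lie algebra of `K` of the metric at `x` under the infinitesimal action,
`(u, v) ↦ g(u^*, v^*)`. -/
def orbitForm (x : X) : EK →L[ℝ] EK →L[ℝ] ℝ :=
  (modelInner g x).bilinearComp
    ((actionDeriv EK EX K x).restrictScalars ℝ) ((actionDeriv EK EX K x).restrictScalars ℝ)

theorem orbitForm_apply (x : X) (u v : EK) :
    orbitForm EK K g x u v = modelInner g x (actionDeriv EK EX K x u) (actionDeriv EK EX K x v) :=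
  rfl

theorem orbitForm_comm (x : X) (u v : EK) : orbitForm EK K g x u v = orbitForm EK K g x v u :=
  g.symm x _ _

theorem orbitForm_self_nonneg (x : X) (u : EK) : 0 ≤ orbitForm EK K g x u u := by
  rcases eq_or_ne (actionDeriv EK EX K x u) 0 with hu | hu
  · simp [orbitForm_apply, hu]
  · exact (g.pos x _ hu).le

variable {g} in
theorem actionDeriv_eq_zero_of_orbitForm_self_eq_zero {x : X} {u : EK}
    (h : orbitForm EK K g x u u = 0) : actionDeriv EK EX K x u = 0 := by
  by_contra hu
  exact (g.pos x _ hu).ne' h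

end OrbitForm

section MomentMap

variable {EL : Type*} [NormedAddCommGroup EL] [NormedSpace ℝ EL]
  {EX : Type*} [NormedAddCommGroup EX] [NormedSpace ℂ EX]
  {L : Type*} [Group L] [TopologicalSpace L] [ChartedSpace EL L]
  {K : Type*} [Group K] {ι : L →* K}
  {X : Type*} [TopologicalSpace X] [ChartedSpace EX X] [IsManifold 𝓘(ℂ, EX) ω X] [MulAction K X]

/-- An equivariant moment map on a Hermitian manifold, with no closedness condition on the
fundamental form. -/
structure IsHermitianMomentMap (ι : L →* K)
    (g : Bundle.ContMDiffRiemannianMetric 𝓘(ℝ, EX) ∞ EX (fun x : X ↦ TangentSpace 𝓘(ℝ, EX) x))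
    (m : X → Module.Dual ℝ (GroupLieAlgebra 𝓘(ℝ, EL) L)) : Prop where
  hermitian : ∀ (x : X) (u v : TangentSpace 𝓘(ℝ, EX) x),
    g.inner x (tangentI x u) (tangentI x v) = g.inner x u v
  contMDiff : ∀ ξ, ContMDiff 𝓘(ℝ, EX) 𝓘(ℝ, ℝ) ∞ (fun x ↦ m x ξ)
  hamiltonian : ∀ ξ (x : X) (v : TangentSpace 𝓘(ℝ, EX) x),
    (mfderiv 𝓘(ℝ, EX) 𝓘(ℝ, ℝ) (fun y ↦ m y ξ) x v : ℝ)
      = fundamentalForm g x (fundamentalVector ι ξ x) v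
  equivariant : ∀ (a : L) (x : X) ξ, m (ι a • x) ξ = m x (lieAd a⁻¹ ξ)

theorem IsMomentMap.isHermitianMomentMap {g : KahlerMetric EX X}
    {m : X → Module.Dual ℝ (GroupLieAlgebra 𝓘(ℝ, EL) L)} (hm : IsMomentMap ι g m) :
    IsHermitianMomentMap ι g.toContMDiffRiemannianMetric m :=
  ⟨g.hermitian, hm.contMDiff, hm.hamiltonian, hm.equivariant⟩

variable {g : Bundle.ContMDiffRiemannianMetric 𝓘(ℝ, EX) ∞ EX (fun x : X ↦ TangentSpace 𝓘(ℝ, EX) x)}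
  {m : X → Module.Dual ℝ (GroupLieAlgebra 𝓘(ℝ, EL) L)}

theorem IsHermitianMomentMap.sub_const (hm : IsHermitianMomentMap ι g m)
    {ζ : Module.Dual ℝ (GroupLieAlgebra 𝓘(ℝ, EL) L)}
    (hζ : ∀ (a : L) (ξ : GroupLieAlgebra 𝓘(ℝ, EL) L), ζ (lieAd a ξ) = ζ ξ) :
    IsHermitianMomentMap ι g (fun x ↦ m x - ζ) where
  hermitian := hm.hermitian
  contMDiff ξ := (hm.contMDiff ξ).sub contMDiff_const
  hamiltonian ξ x v := by
    have hsub : HasModelDerivAt ℝ (fun y ↦ (m y - ζ) ξ) x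
        (modelDeriv ℝ EX ℝ (fun y ↦ m y ξ) x) :=
      (hasModelDerivAt_iff_hasFDerivAt.2 ((hasFDerivAt_id (m x ξ)).sub_const (ζ ξ))).comp
        (hasModelDerivAt_modelDeriv ((hm.contMDiff ξ).mdifferentiable (by simp) x)) rfl
    exact (DFunLike.congr_fun hsub.modelDeriv_eq v).trans (hm.hamiltonian ξ x v)
  equivariant a x ξ := by
    simp only [LinearMap.sub_apply, hm.equivariant, hζ]

variable [FiniteDimensional ℝ EL]

/-- The values of a moment map, as continuous linear forms on the model space. -/
def momentL (m : X → Module.Dual ℝ (GroupLieAlgebra 𝓘(ℝ, EL) L)) (x : X) : EL →L[ℝ] ℝ :=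
  LinearMap.toContinuousLinearMap (show EL →ₗ[ℝ] ℝ from m x)

theorem IsHermitianMomentMap.momentL_map_smul (hm : IsHermitianMomentMap ι g m) (a : L) (x : X)
    (ξ : EL) : momentL m (ι a • x) ξ = momentL m x (lieGroupAd ℝ EL a⁻¹ ξ) :=
  hm.equivariant a x ξ

variable {EK : Type*} [NormedAddCommGroup EK] [NormedSpace ℂ EK]
  [TopologicalSpace K] [ChartedSpace EK K]

omit [FiniteDimensional ℝ EL] in
theorem IsHermitianMomentMap.orbitForm_I_smul_I_smul (hm : IsHermitianMomentMap ι g m) (x : X)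
    (u v : EK) :
    orbitForm EK K g x (Complex.I • u) (Complex.I • v) = orbitForm EK K g x u v := by
  simp only [orbitForm_apply, map_smul]
  exact hm.hermitian x _ _

omit [FiniteDimensional ℝ EL] in
theorem IsHermitianMomentMap.orbitForm_I_smul_left (hm : IsHermitianMomentMap ι g m) (x : X)
    (u v : EK) :
    orbitForm EK K g x (Complex.I • u) v = -orbitForm EK K g x u (Complex.I • v) := by
  rw [← hm.orbitForm_I_smul_I_smul, smul_smul, Complex.I_mul_I, neg_one_smul, map_neg,
    neg_apply]

variable [ContMDiffSMul 𝓘(ℂ, EK) 𝓘(ℂ, EX) ω K X]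

theorem IsHermitianMomentMap.hasModelDerivAt_momentL (hm : IsHermitianMomentMap ι g m)
    (hι : IsComplexification (EL := EL) (EK := EK) ι) (x : X) (ξ : EL) :
    HasModelDerivAt ℝ (fun k : K ↦ momentL m (k • x) ξ) 1
      (orbitForm EK K g x (Complex.I • lieMapL EL EK ι ξ)) := by
  have hmoment : HasModelDerivAt ℝ (fun y : X ↦ momentL m y ξ) x
      (modelDeriv ℝ EX ℝ (fun y ↦ momentL m y ξ) x) :=
    hasModelDerivAt_modelDeriv ((hm.contMDiff ξ).mdifferentiable (by simp) x)
  have hK := hmoment.comp (hasModelDerivAt_smul_point (EK := EK) x) (one_smul K x)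
  convert hK using 1
  ext u
  refine Eq.trans ?_ (hm.hamiltonian ξ x (actionDeriv EK EX K x u)).symm
  rw [hι.fundamentalVector_eq, orbitForm_apply, map_smul]
  rfl

theorem IsHermitianMomentMap.momentL_lieGroupBracket [LieGroup 𝓘(ℝ, EL) ∞ L]
    (hm : IsHermitianMomentMap ι g m)
    (hι : IsComplexification (EL := EL) (EK := EK) ι) (x : X) (ξ η : EL) :
    momentL m x (lieGroupBracket ℝ EL L ξ η)
      = orbitForm EK K g x (Complex.I • lieMapL EL EK ι ξ) (lieMapL EL EK ι η) := by
  have hinv := (hm.hasModelDerivAt_momentL hι x η).comp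
    (hι.hasModelDerivAt_one.comp hasModelDerivAt_inv_one inv_one) (by simp)
  have hAd := (hasModelDerivAt_iff_hasFDerivAt.2 (momentL m x).hasFDerivAt).comp
    (hasModelDerivAt_lieGroupAd_apply (𝕜 := ℝ) (G := L) η) rfl
  simp only [hm.momentL_map_smul, inv_inv] at hinv
  have h := DFunLike.congr_fun (hAd.unique hinv) ξ
  simp only [ContinuousLinearMap.comp_apply, ContinuousLinearMap.flip_apply, neg_apply,
    ContinuousLinearMap.id_apply, map_neg] at h
  rw [h, hm.orbitForm_I_smul_left, neg_neg, orbitForm_comm]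

end MomentMap

/-! ### The potential -/

section RadialPotential

variable {EL : Type*} [NormedAddCommGroup EL] [NormedSpace ℝ EL] [FiniteDimensional ℝ EL]
  {EK : Type*} [NormedAddCommGroup EK] [NormedSpace ℂ EK]
  {EX : Type*} [NormedAddCommGroup EX] [NormedSpace ℂ EX]
  {L : Type*} [Group L] [TopologicalSpace L] [ChartedSpace EL L]
  {K : Type*} [Group K] [TopologicalSpace K] [ChartedSpace EK K]
  {ι : L →* K}
  {X : Type*} [MulAction K X]

variable (EL EK) in
/-- The value of the moment map at `e^{√-1 ξ} x`, as a function of `ξ`. On `L \ L^ℂ`, parametrized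
by `ξ ↦ L e^{√-1 ξ}`, it gives the form `α_{x,0}` in radial directions. -/
def polarMoment (ι : L →* K) (m : X → Module.Dual ℝ (GroupLieAlgebra 𝓘(ℝ, EL) L)) (x : X)
    (ξ : EL) : EL →L[ℝ] ℝ :=
  momentL m (polarExp EL EK ι ξ • x)

variable (EL EK) in
/-- The integral of `α_{x,0}` along the curve `L e^{√-1 s ξ}`, `0 ≤ s ≤ 1`. -/
def radialPotential (ι : L →* K) (m : X → Module.Dual ℝ (GroupLieAlgebra 𝓘(ℝ, EL) L)) (x : X)
    (ξ : EL) : ℝ :=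
  ∫ s in (0 : ℝ)..1, polarMoment EL EK ι m x (s • ξ) ξ

theorem radialPotential_zero (m : X → Module.Dual ℝ (GroupLieAlgebra 𝓘(ℝ, EL) L)) (x : X) :
    radialPotential EL EK ι m x 0 = 0 := by
  simp [radialPotential]

omit [FiniteDimensional ℝ EL] in
theorem IsComplexification.polarLogDeriv_smul_self [CompleteSpace EK]
    [LieGroup 𝓘(ℂ, EK) ω K] (hι : IsComplexification (EL := EL) (EK := EK) ι) (ξ : EL) (s : ℝ) :
    polarLogDeriv EL EK ι (s • ξ) ξ = Complex.I • lieMapL EL EK ι ξ := by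
  have hline : HasVelocityAt (fun t : ℝ ↦ t • ξ) ξ s :=
    hasVelocityAt_iff_hasDerivAt.2 (hasDerivAt_smul_id ξ s)
  exact ((hι.hasModelDerivAt_polarExp_mul_inv (s • ξ)).comp_velocity hline rfl).unique
    ((isOneParameterSubgroup_polarExp ι ξ).hasVelocityAt_mul_inv s)

variable [TopologicalSpace X] [ChartedSpace EX X] [IsManifold 𝓘(ℂ, EX) ω X]
  [ContMDiffSMul 𝓘(ℂ, EK) 𝓘(ℂ, EX) ω K X]
  {g : Bundle.ContMDiffRiemannianMetric 𝓘(ℝ, EX) ∞ EX (fun x : X ↦ TangentSpace 𝓘(ℝ, EX) x)}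
  {m : X → Module.Dual ℝ (GroupLieAlgebra 𝓘(ℝ, EL) L)}
  (hm : IsHermitianMomentMap ι g m) (hι : IsComplexification (EL := EL) (EK := EK) ι)

include hm hι

namespace IsHermitianMomentMap

theorem contDiff_polarMoment (x : X) : ContDiff ℝ ∞ (polarMoment EL EK ι m x) := by
  rw [contDiff_clm_apply_iff]
  intro η
  rw [← contMDiff_iff_contDiff]
  exact (hm.contMDiff η).comp
    (((contMDiff_real_of_complex (contMDiff_smul_point x)).of_le le_top).comp
      hι.contMDiff_polarExp)

variable [LieGroup 𝓘(ℂ, EK) ω K]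

theorem fderiv_polarMoment_apply (x : X) (ξ v η : EL) :
    fderiv ℝ (polarMoment EL EK ι m x) ξ v η
      = orbitForm EK K g (polarExp EL EK ι ξ • x) (Complex.I • lieMapL EL EK ι η)
          (polarLogDeriv EL EK ι ξ v) := by
  have hη := ((hm.contDiff_polarMoment hι x).differentiable (by simp) ξ).hasFDerivAt.clm_apply
    (hasFDerivAt_const η ξ)
  have horbit := (hm.hasModelDerivAt_momentL hι (polarExp EL EK ι ξ • x) η).comp
    (hι.hasModelDerivAt_polarExp_mul_inv ξ) (mul_inv_cancel _)
  simp only [smul_smul, inv_mul_cancel_right] at horbit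
  have h := DFunLike.congr_fun (hη.unique (hasModelDerivAt_iff_hasFDerivAt.1 horbit)) v
  simpa using h

variable [CompleteSpace EK] [LieGroup 𝓘(ℝ, EL) ∞ L]

theorem hasDerivAt_polarMoment_im (x : X) (ξ η : EL) (s : ℝ) :
    HasDerivAt (fun s : ℝ ↦ polarMoment EL EK ι m x (s • ξ)
        (hι.im (polarLogDeriv EL EK ι (s • ξ) (s • η))))
      (fderiv ℝ (polarMoment EL EK ι m x) (s • ξ) (s • η) ξ
        + polarMoment EL EK ι m x (s • ξ) η) s := by
  have hmoment := ((hm.contDiff_polarMoment hι x).differentiable (by simp)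
    (s • ξ)).hasFDerivAt.comp_hasDerivAt s (hasDerivAt_smul_id ξ s)
  have him := hι.im.hasFDerivAt.comp_hasDerivAt s (hι.hasDerivAt_polarLogDeriv_smul ξ η s)
  convert! hmoment.clm_apply him using 1
  simp only [Function.comp_apply, hm.fderiv_polarMoment_apply hι, hι.polarLogDeriv_smul_self]
  set y := polarExp EL EK ι (s • ξ) • x
  set w := polarLogDeriv EL EK ι (s • ξ) (s • η)
  have him_Ad : hι.im (lieGroupAd ℝ EK (polarExp EL EK ι (s • ξ)) (Complex.I • lieMapL EL EK ι η))
      = lieGroupBracket ℝ EL L ξ (hι.re w) + η := by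
    have h := congrArg hι.im (hι.lieGroupAd_polarExp_sub ξ η s)
    rwa [map_sub, hι.im_I_smul_lieMapL, hι.im_lieGroupBracket_I_smul, sub_eq_iff_eq_add] at h
  have hbracket : polarMoment EL EK ι m x (s • ξ) (lieGroupBracket ℝ EL L ξ (hι.re w))
      = orbitForm EK K g y (Complex.I • lieMapL EL EK ι ξ) (lieMapL EL EK ι (hι.re w)) :=
    hm.momentL_lieGroupBracket hι y ξ (hι.re w)
  rw [him_Ad, map_add, ← add_assoc, hbracket,
    orbitForm_comm _ _ (Complex.I • lieMapL EL EK ι (hι.im w)), ← map_add,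
    add_comm (Complex.I • _), hι.re_add_im]

/-- This is where the closedness of `α_{x,0}` enters. -/
theorem hasFDerivAt_radialPotential (x : X) (ξ : EL) :
    HasFDerivAt (radialPotential EL EK ι m x)
      ((polarMoment EL EK ι m x ξ).comp (hι.im.comp (polarLogDeriv EL EK ι ξ))) ξ :=
  hasFDerivAt_radialIntegral ((hm.contDiff_polarMoment hι x).of_le (by simp))
    (hm.hasDerivAt_polarMoment_im hι x ξ) (by simp)

end IsHermitianMomentMap

end RadialPotential

theorem leftCoset_map_mul {L K : Type*} [Group L] [Group K] (ι : L →* K) (a : L) (k : K) :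
    leftCoset ι (ι a * k) = leftCoset ι k :=
  Quotient.sound (QuotientGroup.rightRel_apply.2 ⟨a⁻¹, by simp⟩)

section PolarCoordinates

variable {EL : Type*} [NormedAddCommGroup EL] [NormedSpace ℝ EL]
  {EK : Type*} [NormedAddCommGroup EK] [NormedSpace ℂ EK]
  {L : Type*} [Group L] [TopologicalSpace L] [ChartedSpace EL L]
  {K : Type*} [Group K] [TopologicalSpace K] [ChartedSpace EK K] [LieGroup 𝓘(ℂ, EK) ω K]
  {ι : L →* K}

theorem hasDerivAt_comp_polarExp_of_mul [CompleteSpace EK] {f : K → ℝ} {ξ : EL} {s c : ℝ}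
    (hf : HasDerivAt (fun t : ℝ ↦ f (polarExp EL EK ι (t • ξ) * polarExp EL EK ι (s • ξ))) c 0) :
    HasDerivAt (fun t : ℝ ↦ f (polarExp EL EK ι (t • ξ))) c s := by
  rw [← sub_self s] at hf
  simpa only [← polarExp_add_smul, sub_add_cancel] using hf.comp_sub_const s s

namespace IsComplexification

variable (hι : IsComplexification (EL := EL) (EK := EK) ι)

theorem polarLog_one [CompleteSpace EK] : hι.polarLog 1 = 0 := by
  rw [← polarExp_zero (EL := EL) (EK := EK) ι, hι.polarLog_polarExp]

theorem polarLog_polarExp_mul [CompleteSpace EK] [LieGroup 𝓘(ℝ, EL) ∞ L] (ξ : EL) (k : K) :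
    hι.polarLog (polarExp EL EK ι ξ * k)
      = hι.polarLog (polarExp EL EK ι (lieGroupAd ℝ EL (hι.polarL k)⁻¹ ξ)
          * polarExp EL EK ι (hι.polarLog k)) := by
  rw [← hι.conj_polarExp, map_inv, inv_inv, mul_assoc, hι.map_polarL_mul_polarExp_polarLog,
    mul_assoc, ← map_inv, hι.polarLog_map_mul]

theorem hasModelDerivAt_polarLog_mul (e k : K) :
    HasModelDerivAt ℝ (fun h : K ↦ hι.polarLog (h * e)) k
      (modelDeriv ℝ EK EL (fun h : K ↦ hι.polarLog (h * e)) k) :=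
  hasModelDerivAt_modelDeriv ((hι.contMDiff_polarLog.comp
    (contMDiff_mul_right (I := 𝓘(ℝ, EK)) (n := ∞))).mdifferentiable (by simp) k)

variable [FiniteDimensional ℝ EL]

theorem im_polarLogDeriv_modelDeriv_polarLog (ξ : EL) (u : EK) :
    hι.im (polarLogDeriv EL EK ι ξ
      (modelDeriv ℝ EK EL (fun h : K ↦ hι.polarLog (h * polarExp EL EK ι ξ)) 1 u)) = hι.im u := by
  set e := polarExp EL EK ι ξ
  have hmul : ContMDiff 𝓘(ℝ, EK) 𝓘(ℝ, EK) ∞ fun h : K ↦ h * e := contMDiff_mul_right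
  have hL : HasModelDerivAt ℝ (fun h : K ↦ hι.polarL (h * e)) 1
      (modelDeriv ℝ EK EL (fun h : K ↦ hι.polarL (h * e)) 1) :=
    hasModelDerivAt_modelDeriv ((hι.contMDiff_polarL.comp hmul).mdifferentiable (by simp) 1)
  have hL_one : hι.polarL (1 * e) = 1 := by rw [one_mul, hι.polarL_polarExp]
  have hLog_one : hι.polarLog (1 * e) = ξ := by rw [one_mul, hι.polarLog_polarExp]
  have hprod := (hι.hasModelDerivAt_one.comp hL hL_one).mul_of_eq_one
    ((hι.hasModelDerivAt_polarExp_mul_inv ξ).comp (hι.hasModelDerivAt_polarLog_mul e 1) hLog_one)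
    (by rw [hL_one, map_one]) (by rw [hLog_one, mul_inv_cancel])
  simp only [← mul_assoc, hι.map_polarL_mul_polarExp_polarLog] at hprod
  have hid := (hasModelDerivAt_id (𝕜 := ℝ) (E := EK) (1 : K)).congr
    (.of_forall fun h ↦ (mul_inv_cancel_right h e))
  have h := congrArg hι.im (DFunLike.congr_fun (hid.unique hprod) u)
  simpa [hι.im_lieMapL] using h.symm

end IsComplexification

end PolarCoordinates

section Potential

variable {EL : Type*} [NormedAddCommGroup EL] [NormedSpace ℝ EL] [FiniteDimensional ℝ EL]
  {EK : Type*} [NormedAddCommGroup EK] [NormedSpace ℂ EK]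
  {EX : Type*} [NormedAddCommGroup EX] [NormedSpace ℂ EX]
  {L : Type*} [Group L] [TopologicalSpace L] [ChartedSpace EL L]
  {K : Type*} [Group K] [TopologicalSpace K] [ChartedSpace EK K]
  {ι : L →* K}
  {X : Type*} [MulAction K X] {m : X → Module.Dual ℝ (GroupLieAlgebra 𝓘(ℝ, EL) L)}

theorem IsNormalizedPrimitive.hasDerivAt_polarExp {x : X} {Φ : LeftQuotient ι → ℝ}
    (hΦ : IsNormalizedPrimitive (EK := EK) ι m 0 x Φ) (k : K) (ξ : EL) :
    HasDerivAt (fun t : ℝ ↦ Φ (leftCoset ι (polarExp EL EK ι (t • ξ) * k)))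
      (momentL m (k • x) ξ) 0 := by
  have hderiv := hΦ.deriv_eq k ξ
  rw [sub_zero] at hderiv
  simp only [← expI_eq_polarExp]
  exact hderiv

variable [CompleteSpace EK] [LieGroup 𝓘(ℂ, EK) ω K]
  [TopologicalSpace X] [ChartedSpace EX X] [IsManifold 𝓘(ℂ, EX) ω X]
  [ContMDiffSMul 𝓘(ℂ, EK) 𝓘(ℂ, EX) ω K X]
  {g : Bundle.ContMDiffRiemannianMetric 𝓘(ℝ, EX) ∞ EX (fun x : X ↦ TangentSpace 𝓘(ℝ, EX) x)}
  (hm : IsHermitianMomentMap ι g m) (hι : IsComplexification (EL := EL) (EK := EK) ι)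

include hm

namespace IsHermitianMomentMap

theorem eq_radialPotential_polarLog (x : X) {f : K → ℝ} (hleft : ∀ (a : L) k, f (ι a * k) = f k)
    (hone : f 1 = 0)
    (hderiv : ∀ (k : K) (ξ : EL), HasDerivAt (fun t : ℝ ↦ f (polarExp EL EK ι (t • ξ) * k))
      (momentL m (k • x) ξ) 0) (k : K) :
    f k = radialPotential EL EK ι m x (hι.polarLog k) := by
  set ξ := hι.polarLog k with hξ
  have hcont : Continuous fun s : ℝ ↦ polarMoment EL EK ι m x (s • ξ) ξ :=
    ((hm.contDiff_polarMoment hι x).continuous.comp (by fun_prop)).clm_apply continuous_const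
  have hFTC := intervalIntegral.integral_eq_sub_of_hasDerivAt (a := 0) (b := 1)
    (fun s _ ↦ hasDerivAt_comp_polarExp_of_mul (hderiv (polarExp EL EK ι (s • ξ)) ξ))
    (hcont.intervalIntegrable _ _)
  rw [one_smul, zero_smul, polarExp_zero, hone, sub_zero] at hFTC
  rw [← hι.map_polarL_mul_polarExp_polarLog k, hleft, ← hξ]
  exact hFTC.symm

theorem primitive_eq_radialPotential {x : X} {Φ : LeftQuotient ι → ℝ}
    (hΦ : IsNormalizedPrimitive (EK := EK) ι m 0 x Φ) (k : K) :
    Φ (leftCoset ι k) = radialPotential EL EK ι m x (hι.polarLog k) :=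
  hm.eq_radialPotential_polarLog hι x (f := fun k ↦ Φ (leftCoset ι k))
    (fun a k ↦ by rw [leftCoset_map_mul]) hΦ.normalized hΦ.hasDerivAt_polarExp k

variable [LieGroup 𝓘(ℝ, EL) ∞ L]

theorem hasModelDerivAt_radialPotential_polarLog_mul (x : X) (ξ : EL) :
    HasModelDerivAt ℝ
      (fun h : K ↦ radialPotential EL EK ι m x (hι.polarLog (h * polarExp EL EK ι ξ))) 1
      ((polarMoment EL EK ι m x ξ).comp hι.im) := by
  have hderiv : (polarMoment EL EK ι m x ξ).comp hι.im
      = ((polarMoment EL EK ι m x ξ).comp (hι.im.comp (polarLogDeriv EL EK ι ξ))).comp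
        (modelDeriv ℝ EK EL (fun h : K ↦ hι.polarLog (h * polarExp EL EK ι ξ)) 1) :=
    ContinuousLinearMap.ext fun u ↦ congrArg (polarMoment EL EK ι m x ξ)
      (hι.im_polarLogDeriv_modelDeriv_polarLog ξ u).symm
  rw [hderiv]
  exact (hasModelDerivAt_iff_hasFDerivAt.2 (hm.hasFDerivAt_radialPotential hι x ξ)).comp
    (hι.hasModelDerivAt_polarLog_mul _ 1) (by simp [hι.polarLog_polarExp])

theorem hasDerivAt_radialPotential_polarLog (x : X) (k : K) (ξ : EL) :
    HasDerivAt
      (fun t : ℝ ↦ radialPotential EL EK ι m x (hι.polarLog (polarExp EL EK ι (t • ξ) * k)))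
      (momentL m (k • x) ξ) 0 := by
  set η := lieGroupAd ℝ EL (hι.polarL k)⁻¹ ξ with hη
  have hmoment : momentL m (k • x) ξ = polarMoment EL EK ι m x (hι.polarLog k) η := by
    rw [polarMoment, hη, ← hm.momentL_map_smul, smul_smul, hι.map_polarL_mul_polarExp_polarLog]
  have hvel := (hm.hasModelDerivAt_radialPotential_polarLog_mul hι x (hι.polarLog k)).comp_velocity
    (isOneParameterSubgroup_polarExp ι η).hasVelocityAt_zero
    (isOneParameterSubgroup_polarExp ι η).map_zero
  simp only [hι.polarLog_polarExp_mul _ k, map_smul, ← hη, hmoment]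
  simpa [hι.im_I_smul_lieMapL] using hasVelocityAt_iff_hasDerivAt.1 hvel

include hι

theorem exists_isNormalizedPrimitive (x : X) :
    ∃ Φ : LeftQuotient ι → ℝ, IsNormalizedPrimitive (EK := EK) ι m 0 x Φ := by
  have hlift (a b : K) (hab : QuotientGroup.rightRel ι.range a b) :
      radialPotential EL EK ι m x (hι.polarLog a)
        = radialPotential EL EK ι m x (hι.polarLog b) := by
    obtain ⟨c, hc⟩ := QuotientGroup.rightRel_apply.1 hab
    rw [← hι.polarLog_map_mul c a, hc, inv_mul_cancel_right]
  refine ⟨Quotient.lift (fun k ↦ radialPotential EL EK ι m x (hι.polarLog k)) hlift,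
    ?_, fun k (ξ : EL) ↦ ?_, ?_⟩
  · have hdiff : MDifferentiable 𝓘(ℝ, EL) 𝓘(ℝ, ℝ) (radialPotential EL EK ι m x) :=
      Differentiable.mdifferentiable fun ξ ↦
        (hm.hasFDerivAt_radialPotential hι x ξ).differentiableAt
    exact hdiff.comp (hι.contMDiff_polarLog.mdifferentiable (by simp))
  · have hderiv := hm.hasDerivAt_radialPotential_polarLog hι x k ξ
    simp only [← expI_eq_polarExp] at hderiv
    rw [sub_zero]
    exact hderiv
  · exact (congrArg _ hι.polarLog_one).trans (radialPotential_zero m x)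

theorem existsUnique_isNormalizedPrimitive (x : X) :
    ∃! Φ : LeftQuotient ι → ℝ, IsNormalizedPrimitive (EK := EK) ι m 0 x Φ := by
  refine existsUnique_of_exists_of_unique (hm.exists_isNormalizedPrimitive hι x)
    fun Φ Ψ hΦ hΨ ↦ funext fun p ↦ ?_
  induction p using Quotient.inductionOn with
  | h k =>
    exact (hm.primitive_eq_radialPotential hι hΦ k).trans
      (hm.primitive_eq_radialPotential hι hΨ k).symm

theorem isNormalizedPrimitive_potential (x : X) :
    IsNormalizedPrimitive (EK := EK) ι m 0 x (potential EK ι m 0 x) :=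
  Classical.epsilon_spec (hm.exists_isNormalizedPrimitive hι x)

theorem potential_leftCoset (x : X) (k : K) :
    potential EK ι m 0 x (leftCoset ι k) = radialPotential EL EK ι m x (hι.polarLog k) :=
  hm.primitive_eq_radialPotential hι (hm.isNormalizedPrimitive_potential hι x) k

/-- Both sides are primitives of `α_{kx,0}` in the variable `h`. -/
theorem potential_mul (x : X) (h k : K) :
    potential EK ι m 0 x (leftCoset ι (h * k))
      = potential EK ι m 0 (k • x) (leftCoset ι h) + potential EK ι m 0 x (leftCoset ι k) := by
  have hx := hm.isNormalizedPrimitive_potential hι x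
  rw [hm.potential_leftCoset hι (k • x), ← sub_eq_iff_eq_add]
  refine hm.eq_radialPotential_polarLog hι (k • x)
    (f := fun h ↦ potential EK ι m 0 x (leftCoset ι (h * k)) - potential EK ι m 0 x (leftCoset ι k))
    (fun a h ↦ by rw [mul_assoc, leftCoset_map_mul]) (by simp) (fun h ξ ↦ ?_) h
  simp only [mul_assoc, smul_smul]
  exact (hx.hasDerivAt_polarExp (h * k) ξ).sub_const _

theorem hasDerivAt_potential (x : X) (ξ : EL) (s : ℝ) :
    HasDerivAt (fun t : ℝ ↦ potential EK ι m 0 x (leftCoset ι (polarExp EL EK ι (t • ξ))))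
      (polarMoment EL EK ι m x (s • ξ) ξ) s :=
  hasDerivAt_comp_polarExp_of_mul (f := fun k ↦ potential EK ι m 0 x (leftCoset ι k))
    ((hm.isNormalizedPrimitive_potential hι x).hasDerivAt_polarExp _ ξ)

omit [LieGroup 𝓘(ℝ, EL) ∞ L] in
theorem hasDerivAt_polarMoment (x : X) (ξ : EL) (s : ℝ) :
    HasDerivAt (fun t : ℝ ↦ polarMoment EL EK ι m x (t • ξ) ξ)
      (orbitForm EK K g (polarExp EL EK ι (s • ξ) • x) (lieMapL EL EK ι ξ) (lieMapL EL EK ι ξ))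
      s := by
  have hmoment := ((hm.contDiff_polarMoment hι x).differentiable (by simp)
    (s • ξ)).hasFDerivAt.comp_hasDerivAt s (hasDerivAt_smul_id ξ s)
  convert! hmoment.clm_apply (hasDerivAt_const s ξ) using 1
  rw [hm.fderiv_polarMoment_apply hι, hι.polarLogDeriv_smul_self, hm.orbitForm_I_smul_I_smul,
    map_zero, add_zero]

theorem convexOn_potential (x : X) (ξ : EL) :
    ConvexOn ℝ univ
      (fun t : ℝ ↦ potential EK ι m 0 x (leftCoset ι (polarExp EL EK ι (t • ξ)))) := by
  have hderiv : deriv (fun t : ℝ ↦ potential EK ι m 0 x (leftCoset ι (polarExp EL EK ι (t • ξ))))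
      = fun t ↦ polarMoment EL EK ι m x (t • ξ) ξ :=
    funext fun s ↦ (hm.hasDerivAt_potential hι x ξ s).deriv
  refine convexOn_univ_of_deriv2_nonneg
    (fun s ↦ (hm.hasDerivAt_potential hι x ξ s).differentiableAt) ?_ fun s ↦ ?_
  · rw [hderiv]
    exact fun s ↦ (hm.hasDerivAt_polarMoment hι x ξ s).differentiableAt
  · rw [Function.iterate_succ, Function.iterate_one, Function.comp_apply, hderiv,
      (hm.hasDerivAt_polarMoment hι x ξ s).deriv]
    exact orbitForm_self_nonneg g _ _

end IsHermitianMomentMap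

end Potential

/-! ### The Gauss lemma -/

section InvariantForm

variable {EL : Type*} [NormedAddCommGroup EL] [NormedSpace ℝ EL]
  {L : Type*} [Group L] [TopologicalSpace L] [ChartedSpace EL L]

/-- An `Ad`-invariant inner product on the Lie algebra of `L`. -/
structure IsInvariantForm (L : Type*) [Group L] [TopologicalSpace L] [ChartedSpace EL L]
    (q : EL →L[ℝ] EL →L[ℝ] ℝ) : Prop where
  symm : ∀ u v, q u v = q v u
  pos : ∀ u, u ≠ 0 → 0 < q u u
  invariant : ∀ (a : L) u v, q (lieGroupAd ℝ EL a u) (lieGroupAd ℝ EL a v) = q u v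

/-- The pullback of a Euclidean inner product under `Ad`, to be averaged over `L`. -/
def adInner [FiniteDimensional ℝ EL] (a : L) : EL →L[ℝ] EL →L[ℝ] ℝ :=
  ((innerSL ℝ : EuclideanSpace ℝ (Fin (Module.finrank ℝ EL)) →L[ℝ] _).bilinearComp
    (toEuclidean : EL ≃L[ℝ] _).toContinuousLinearMap
    (toEuclidean : EL ≃L[ℝ] _).toContinuousLinearMap).bilinearComp
      (lieGroupAd ℝ EL a) (lieGroupAd ℝ EL a)

theorem adInner_apply [FiniteDimensional ℝ EL] (a : L) (u v : EL) :
    adInner a u v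
      = inner ℝ (toEuclidean (lieGroupAd ℝ EL a u)) (toEuclidean (lieGroupAd ℝ EL a v)) := rfl

variable [LieGroup 𝓘(ℝ, EL) ∞ L]

theorem continuous_adInner [FiniteDimensional ℝ EL] :
    Continuous (adInner : L → EL →L[ℝ] EL →L[ℝ] ℝ) := by
  have := (contMDiff_lieGroupAd ℝ EL (G := L)).continuous
  rw [continuous_clm_apply]
  intro u
  rw [continuous_clm_apply]
  intro v
  simp only [adInner_apply]
  fun_prop

open MeasureTheory in
set_option maxSynthPendingDepth 3 in
theorem exists_isInvariantForm [FiniteDimensional ℝ EL] [CompactSpace L] :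
    ∃ q : EL →L[ℝ] EL →L[ℝ] ℝ, IsInvariantForm L q := by
  have := topologicalGroup_of_lieGroup 𝓘(ℝ, EL) ∞ (G := L)
  have := t2Space_of_lieGroup EL L
  let _ : MeasurableSpace L := borel L
  have : BorelSpace L := ⟨rfl⟩
  let μ : Measure L := Measure.haar
  have hcont : Continuous fun a : L ↦ (adInner a⁻¹ : EL →L[ℝ] EL →L[ℝ] ℝ) :=
    continuous_adInner.comp continuous_inv
  have hint : Integrable (fun a : L ↦ (adInner a⁻¹ : EL →L[ℝ] EL →L[ℝ] ℝ)) μ :=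
    hcont.integrable_of_hasCompactSupport (HasCompactSupport.of_compactSpace _)
  have hq (u v : EL) : (∫ a : L, adInner a⁻¹ ∂μ) u v = ∫ a : L, adInner a⁻¹ u v ∂μ := by
    rw [ContinuousLinearMap.integral_apply hint, ContinuousLinearMap.integral_apply
      (hint.apply_continuousLinearMap u)]
  refine ⟨∫ a : L, adInner a⁻¹ ∂μ, fun u v ↦ ?_, fun u hu ↦ ?_, fun b u v ↦ ?_⟩
  · simp only [hq, adInner_apply, real_inner_comm]
  · rw [hq]
    refine Continuous.integral_pos_of_hasCompactSupport_nonneg_nonzero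
      ((hcont.clm_apply continuous_const).clm_apply continuous_const)
      (HasCompactSupport.of_compactSpace _)
      (fun a ↦ real_inner_self_nonneg (x := toEuclidean (lieGroupAd ℝ EL a⁻¹ u))) (x := 1) ?_
    simpa [adInner_apply, lieGroupAd_one] using hu
  · rw [hq, hq, ← integral_mul_left_eq_self (fun a ↦ adInner a⁻¹ u v) b⁻¹]
    simp only [adInner_apply, lieGroupAd_mul, mul_inv_rev, inv_inv]

theorem IsInvariantForm.apply_lieGroupBracket [CompleteSpace EL] {q : EL →L[ℝ] EL →L[ℝ] ℝ}
    (hq : IsInvariantForm L q) (ξ η : EL) : q ξ (lieGroupBracket ℝ EL L ξ η) = 0 := by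
  have h := isOneParameterSubgroup_lieExp (G := L) ξ
  have hderiv := (q ξ).hasFDerivAt.comp_hasDerivAt (0 : ℝ)
    (hasDerivAt_lieGroupAd (h.hasVelocityAt_mul_inv 0) η)
  have hconst : (q ξ ∘ fun s : ℝ ↦ lieGroupAd ℝ EL (lieExp (E := EL) (G := L) (s • ξ : EL)) η)
      = fun _ ↦ q ξ η := by
    funext s
    simpa only [h.lieGroupAd_self s, Function.comp_apply] using
      hq.invariant (lieExp (E := EL) (G := L) (s • ξ : EL)) ξ η
  rw [hconst] at hderiv
  simpa only [h.map_zero, lieGroupAd_one] using hderiv.unique (hasDerivAt_const _ _)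

end InvariantForm

section GaussLemma

variable {EL : Type*} [NormedAddCommGroup EL] [NormedSpace ℝ EL] [FiniteDimensional ℝ EL]
  {EK : Type*} [NormedAddCommGroup EK] [NormedSpace ℂ EK]
  {L : Type*} [Group L] [TopologicalSpace L] [ChartedSpace EL L] [LieGroup 𝓘(ℝ, EL) ∞ L]
  {K : Type*} [Group K] [TopologicalSpace K] [ChartedSpace EK K] [LieGroup 𝓘(ℂ, EK) ω K]
  {ι : L →* K} {q : EL →L[ℝ] EL →L[ℝ] ℝ} (hq : IsInvariantForm L q)
  (hι : IsComplexification (EL := EL) (EK := EK) ι)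

namespace IsInvariantForm

include hq

theorem apply_im_lieGroupBracket (ξ : EL) (u : EK) :
    q ξ (hι.im (lieGroupBracket ℝ EK K (Complex.I • lieMapL EL EK ι ξ) u)) = 0 := by
  have := FiniteDimensional.complete ℝ EL
  rw [hι.im_lieGroupBracket_I_smul, hq.apply_lieGroupBracket]

variable [CompleteSpace EK]

theorem apply_im_lieGroupAd_polarExp (ξ : EL) (v : EK) :
    q ξ (hι.im (lieGroupAd ℝ EK (polarExp EL EK ι ξ) v)) = q ξ (hι.im v) := by
  have hderiv (s : ℝ) := ((q ξ).comp hι.im).hasFDerivAt.comp_hasDerivAt s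
    (hasDerivAt_lieGroupAd_polarExp ι ξ v s)
  have hconst := is_const_of_deriv_eq_zero (fun s ↦ (hderiv s).differentiableAt)
    (fun s ↦ (hderiv s).deriv.trans (hq.apply_im_lieGroupBracket hι ξ _)) 1 0
  simpa [polarExp_zero, lieGroupAd_one] using hconst

theorem apply_im_polarLogDeriv (ξ η : EL) :
    q ξ (hι.im (polarLogDeriv EL EK ι ξ η)) = q ξ η := by
  have hderiv (s : ℝ) : HasDerivAt
      (fun s : ℝ ↦ q ξ (hι.im (polarLogDeriv EL EK ι (s • ξ) (s • η))) - s * q ξ η) 0 s := by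
    have h := (((q ξ).comp hι.im).hasFDerivAt.comp_hasDerivAt s
      (hι.hasDerivAt_polarLogDeriv_smul ξ η s)).sub ((hasDerivAt_id s).mul_const (q ξ η))
    refine h.congr_deriv ?_
    rw [← sub_add_cancel (lieGroupAd ℝ EK (polarExp EL EK ι (s • ξ)) _)
      (Complex.I • lieMapL EL EK ι η), hι.lieGroupAd_polarExp_sub ξ η s,
      ContinuousLinearMap.comp_apply, map_add, map_add, hq.apply_im_lieGroupBracket hι,
      hι.im_I_smul_lieMapL, zero_add, one_mul, sub_self]
  have hconst := is_const_of_deriv_eq_zero (fun s ↦ (hderiv s).differentiableAt)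
    (fun s ↦ (hderiv s).deriv) 1 0
  simpa [sub_eq_zero] using hconst

theorem apply_modelDeriv_polarLog_mul (ξ : EL) (u : EK) :
    q ξ (modelDeriv ℝ EK EL (fun h : K ↦ hι.polarLog (h * polarExp EL EK ι ξ)) 1 u)
      = q ξ (hι.im u) := by
  rw [← hq.apply_im_polarLogDeriv hι, hι.im_polarLogDeriv_modelDeriv_polarLog]

/-- The Gauss lemma for `L \ L^ℂ`: radial geodesics are orthogonal to spheres. -/
theorem hasDerivAt_polarLog_sq (ξ : EL) (v : EK) :
    HasDerivAt (fun t : ℝ ↦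
      q (hι.polarLog (polarExp EL EK ι ξ * lieExp (E := EK) (G := K) (t • v : EK)))
        (hι.polarLog (polarExp EL EK ι ξ * lieExp (E := EK) (G := K) (t • v : EK))))
      (2 * q ξ (hι.im v)) 0 := by
  have hv := isOneParameterSubgroup_lieExp (G := K) v
  have hone : lieExp (E := EK) (G := K) ((0 : ℝ) • v : EK) = 1 := hv.map_zero
  have hvel := hasVelocityAt_iff_hasDerivAt.1
    ((hι.hasModelDerivAt_polarLog_mul (polarExp EL EK ι ξ) 1).comp_velocity
      (hv.conj (polarExp EL EK ι ξ)).hasVelocityAt_zero (by rw [hone, mul_one, mul_inv_cancel]))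
  simp only [inv_mul_cancel_right] at hvel
  refine ((q.hasFDerivAt.comp_hasDerivAt 0 hvel).clm_apply hvel).congr_deriv ?_
  simp only [Function.comp_apply, hone, mul_one, hι.polarLog_polarExp]
  rw [hq.symm _ ξ, hq.apply_modelDeriv_polarLog_mul, hq.apply_im_lieGroupAd_polarExp, two_mul]

end IsInvariantForm

end GaussLemma

/-! ### Minima of functions convex along rays -/

section MinimumOnRays

variable {E : Type*} [NormedAddCommGroup E] [NormedSpace ℝ E] [FiniteDimensional ℝ E]
  {φ : E → ℝ}

theorem exists_subseq_tendsto_normalize {ξ : ℕ → E} (hξ : Tendsto (fun n ↦ ‖ξ n‖) atTop atTop) :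
    ∃ u : E, ‖u‖ = 1 ∧ ∃ σ : ℕ → ℕ, StrictMono σ ∧
      Tendsto (fun n ↦ ‖ξ (σ n)‖⁻¹ • ξ (σ n)) atTop (𝓝 u) := by
  have := FiniteDimensional.proper_real E
  have hsphere : ∀ᶠ n in atTop, ‖ξ n‖⁻¹ • ξ n ∈ Metric.sphere (0 : E) 1 := by
    filter_upwards [hξ.eventually_gt_atTop 0] with n hn
    rw [mem_sphere_zero_iff_norm, norm_smul, norm_inv, norm_norm, inv_mul_cancel₀ hn.ne']
  obtain ⟨u, hu, σ, hσ, hlim⟩ := (isCompact_sphere (0 : E) 1).tendsto_subseq' hsphere.frequently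
  exact ⟨u, mem_sphere_zero_iff_norm.1 hu, σ, hσ, hlim⟩

omit [FiniteDimensional ℝ E] in
theorem apply_smul_le_of_tendsto_normalize (hφ : Continuous φ)
    (hconv : ∀ ξ, ConvexOn ℝ univ fun t : ℝ ↦ φ (t • ξ)) {ξ : ℕ → E}
    (hξ : Tendsto (fun n ↦ ‖ξ n‖) atTop atTop) (hle : ∀ n, φ (ξ n) ≤ φ 0) {u : E}
    (hu : Tendsto (fun n ↦ ‖ξ n‖⁻¹ • ξ n) atTop (𝓝 u)) {t : ℝ} (ht : 0 ≤ t) :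
    φ (t • u) ≤ φ 0 := by
  refine le_of_tendsto ((hφ.tendsto _).comp (hu.const_smul t)) ?_
  filter_upwards [hξ.eventually_gt_atTop 0, hξ.eventually_ge_atTop t] with n hn hnt
  set s := t * ‖ξ n‖⁻¹ with hs
  have hs_nonneg : 0 ≤ s := by positivity
  have hs_le : s ≤ 1 := by rwa [hs, ← div_eq_mul_inv, div_le_one hn]
  have hseg := (hconv (ξ n)).2 (mem_univ (0 : ℝ)) (mem_univ (1 : ℝ)) (sub_nonneg.2 hs_le)
    hs_nonneg (sub_add_cancel 1 s)
  simp only [zero_smul, one_smul, smul_eq_mul, mul_zero, mul_one, zero_add] at hseg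
  rw [Function.comp_apply, smul_smul, ← hs]
  calc φ (s • ξ n) ≤ (1 - s) * φ 0 + s * φ (ξ n) := hseg
    _ ≤ (1 - s) * φ 0 + s * φ 0 := by gcongr; exact hle n
    _ = φ 0 := by ring

variable {q : E →L[ℝ] E →L[ℝ] ℝ}

theorem exists_pos_mul_sq_le_of_posDef (hq : ∀ u, u ≠ 0 → 0 < q u u) :
    ∃ c > 0, ∀ u, c * ‖u‖ ^ 2 ≤ q u u := by
  rcases subsingleton_or_nontrivial E with hE | hE
  · exact ⟨1, one_pos, fun u ↦ by simp [Subsingleton.elim u 0]⟩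
  have := FiniteDimensional.proper_real E
  have hqc : Continuous fun u : E ↦ q u u := by fun_prop
  obtain ⟨p, hp, hmin⟩ := (isCompact_sphere (0 : E) 1).exists_isMinOn
    (NormedSpace.sphere_nonempty.2 zero_le_one) hqc.continuousOn
  refine ⟨q p p, hq p (ne_zero_of_mem_unit_sphere ⟨p, hp⟩), fun u ↦ ?_⟩
  rcases eq_or_ne u 0 with rfl | hu
  · simp
  have hnormalize : q p p ≤ q (‖u‖⁻¹ • u) (‖u‖⁻¹ • u) :=
    hmin (mem_sphere_zero_iff_norm.2 (norm_smul_inv_norm (𝕜 := ℝ) hu))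
  calc q p p * ‖u‖ ^ 2 ≤ q (‖u‖⁻¹ • u) (‖u‖⁻¹ • u) * ‖u‖ ^ 2 := by gcongr
    _ = q u u := by
      simp only [map_smul, smul_apply, smul_eq_mul]
      field_simp [norm_ne_zero_iff.2 hu]

theorem isCompact_setOf_apply_self_le (hq : ∀ u, u ≠ 0 → 0 < q u u) (r : ℝ) :
    IsCompact {u : E | q u u ≤ r} := by
  have := FiniteDimensional.proper_real E
  obtain ⟨c, hc, hcq⟩ := exists_pos_mul_sq_le_of_posDef hq
  have hqc : Continuous fun u : E ↦ q u u := by fun_prop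
  refine Metric.isCompact_of_isClosed_isBounded (isClosed_le hqc continuous_const)
    ((Metric.isBounded_iff_subset_closedBall 0).2 ⟨√(r / c), fun u hu ↦ ?_⟩)
  rw [mem_closedBall_zero_iff]
  refine Real.le_sqrt_of_sq_le ?_
  rw [le_div_iff₀ hc, mul_comm]
  exact (hcq u).trans hu

theorem exists_forall_le_of_sq_le (hq : ∀ u, u ≠ 0 → 0 < q u u) (hφ : Continuous φ) {r : ℝ}
    (hr : 0 ≤ r) :
    ∃ ξ, (∀ η, q η η ≤ r → φ ξ ≤ φ η) ∧ ∀ η, φ η = φ ξ → q ξ ξ ≤ q η η := by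
  have hqc : Continuous fun u : E ↦ q u u := by fun_prop
  have hcompact := isCompact_setOf_apply_self_le hq r
  obtain ⟨p, hp, hpmin⟩ := hcompact.exists_isMinOn ⟨0, by simpa using hr⟩ hφ.continuousOn
  obtain ⟨ξ, ⟨hξr, hξp : φ ξ = φ p⟩, hξmin⟩ := (hcompact.inter_right
    (isClosed_eq hφ (continuous_const (y := φ p)))).exists_isMinOn ⟨p, hp, rfl⟩ hqc.continuousOn
  refine ⟨ξ, fun η hη ↦ hξp.trans_le (hpmin hη), fun η hη ↦ ?_⟩
  rcases le_total (q η η) r with hηr | hηr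
  · exact hξmin ⟨hηr, hη.trans hξp⟩
  · exact le_trans hξr hηr

theorem tendsto_norm_atTop_of_forall_exists_lt (hφ : Continuous φ) (hno : ∀ p, ∃ η, φ η < φ p)
    {ξ : ℕ → E} (hξ : ∀ η, ∀ᶠ n in atTop, φ (ξ n) ≤ φ η) :
    Tendsto (fun n ↦ ‖ξ n‖) atTop atTop := by
  have := FiniteDimensional.proper_real E
  refine tendsto_atTop.2 fun R ↦ ?_
  obtain ⟨p, -, hpmin⟩ := (isCompact_closedBall (0 : E) (max R 0)).exists_isMinOn
    (Metric.nonempty_closedBall.2 (le_max_right _ _)) hφ.continuousOn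
  obtain ⟨η, hη⟩ := hno p
  filter_upwards [hξ η] with n hn
  by_contra! hlt
  have hp : φ p ≤ φ (ξ n) := hpmin (mem_closedBall_zero_iff.2 (hlt.le.trans (le_max_left _ _)))
  exact (hp.trans hn).not_gt hη

/-- If `φ` had no minimum, its shortest minimisers on growing balls would accumulate at a
direction in which `φ` stays bounded; by `hdir` this direction lies in `V`, by `horth` it is
orthogonal to itself. -/
theorem exists_forall_le_of_convexOn_rays (hq : ∀ u, u ≠ 0 → 0 < q u u) (hφ : Continuous φ)
    (hconv : ∀ ξ, ConvexOn ℝ univ fun t : ℝ ↦ φ (t • ξ)) {V : Set E}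
    (hdir : ∀ ξ, ξ ∉ V → Tendsto (fun t : ℝ ↦ φ (t • ξ)) atTop atTop)
    (horth : ∀ ξ, (∀ η, φ η = φ ξ → q ξ ξ ≤ q η η) → ∀ b ∈ V, q ξ b = 0) :
    ∃ ξ₀, ∀ ξ, φ ξ₀ ≤ φ ξ := by
  by_contra! hno
  choose ξ hξmin hξlevel using fun n : ℕ ↦ exists_forall_le_of_sq_le hq hφ n.cast_nonneg
  have hnorm := tendsto_norm_atTop_of_forall_exists_lt hφ hno fun η ↦
    (tendsto_natCast_atTop_atTop.eventually_ge_atTop (q η η)).mono fun n ↦ hξmin n η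
  obtain ⟨u, hu, σ, hσ, hlim⟩ := exists_subseq_tendsto_normalize hnorm
  have hbounded (t : ℝ) (ht : 0 ≤ t) : φ (t • u) ≤ φ 0 :=
    apply_smul_le_of_tendsto_normalize hφ hconv (hnorm.comp hσ.tendsto_atTop)
      (fun n ↦ hξmin (σ n) 0 (by simp)) hlim ht
  have huV : u ∈ V := by
    by_contra huV
    obtain ⟨t, ht, hlt⟩ := ((eventually_ge_atTop 0).and
      ((hdir u huV).eventually_gt_atTop (φ 0))).exists
    exact (hbounded t ht).not_gt hlt
  have hself : q u u = 0 := by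
    refine tendsto_nhds_unique ((q.flip u).continuous.continuousAt.tendsto.comp hlim)
      (tendsto_const_nhds.congr fun n ↦ ?_)
    simp [horth _ (hξlevel (σ n)) u huV]
  exact (hq u (norm_ne_zero_iff.1 (by simp [hu]))).ne' hself

end MinimumOnRays

section ConvexOnReal

variable {f : ℝ → ℝ} {f' s : ℝ}

theorem add_mul_sub_le_of_convexOn_of_hasDerivAt (hf : ConvexOn ℝ univ f)
    (hf' : HasDerivAt f f' s) {t : ℝ} (hst : s ≤ t) : f s + f' * (t - s) ≤ f t := by
  rcases hst.eq_or_lt with rfl | hst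
  · simp
  have hslope := hf.le_slope_of_hasDerivAt (mem_univ s) (mem_univ t) hst hf'
  rw [slope_def_field, le_div_iff₀ (sub_pos.2 hst)] at hslope
  linarith

theorem tendsto_atTop_of_convexOn_of_hasDerivAt_pos (hf : ConvexOn ℝ univ f)
    (hf' : HasDerivAt f f' s) (hpos : 0 < f') : Tendsto f atTop atTop :=
  tendsto_atTop_mono' atTop
    ((eventually_ge_atTop s).mono fun _ ↦ add_mul_sub_le_of_convexOn_of_hasDerivAt hf hf')
    (tendsto_atTop_add_const_left _ _
      ((tendsto_atTop_add_const_right _ (-s) tendsto_id).const_mul_atTop hpos))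

theorem exists_pos_of_hasDerivAt_pos (hf' : HasDerivAt f f' s) (hpos : 0 < f') (hs : f s = 0) :
    ∃ t > s, 0 < f t := by
  obtain ⟨r, hr, hr_pos : 0 < r⟩ := ((hf'.tendsto_slope_zero_right.eventually_const_lt hpos).and
    self_mem_nhdsWithin).exists
  refine ⟨s + r, lt_add_of_pos_right s hr_pos, ?_⟩
  rw [hs, sub_zero, smul_eq_mul] at hr
  exact pos_of_mul_pos_right hr (inv_nonneg.2 hr_pos.le)

end ConvexOnReal

theorem eq_of_hasVelocityAt_zero {E : Type*} [NormedAddCommGroup E] [NormedSpace ℝ E]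
    {M : Type*} [TopologicalSpace M] [ChartedSpace E M] [IsManifold 𝓘(ℝ, E) 1 M] {γ : ℝ → M}
    (hγ : ∀ t, HasVelocityAt γ (0 : E) t) (s t : ℝ) : γ s = γ t := by
  suffices IsLocallyConstant γ from this.apply_eq_of_preconnectedSpace s t
  refine (IsLocallyConstant.iff_eventually_eq γ).2 fun s ↦ ?_
  set e := chartAt E (γ s)
  obtain ⟨r, hr, hball⟩ := Metric.mem_nhds_iff.1
    ((hγ s).1.preimage_mem_nhds (chart_source_mem_nhds E (γ s)))
  have hderiv (t : ℝ) (ht : t ∈ Metric.ball s r) : HasDerivAt (fun t ↦ e (γ t)) 0 t := by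
    have he := hasModelDerivAt_modelDeriv (mdifferentiableAt_extChartAt (I := 𝓘(ℝ, E)) (hball ht))
    simpa [hasVelocityAt_iff_hasDerivAt] using he.comp_velocity (hγ t) rfl
  filter_upwards [Metric.ball_mem_nhds s hr] with t ht
  exact e.injOn (hball ht) (mem_chart_source E (γ s)) <|
    Metric.isOpen_ball.is_const_of_deriv_eq_zero (convex_ball s r).isPreconnected
      (fun t ht ↦ (hderiv t ht).differentiableAt.differentiableWithinAt)
      (fun t ht ↦ (hderiv t ht).deriv) ht (Metric.mem_ball_self hr)

theorem mem_stabLie_of_actionDeriv_eq_zero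
    {EK : Type*} [NormedAddCommGroup EK] [NormedSpace ℂ EK] [CompleteSpace EK]
    {EX : Type*} [NormedAddCommGroup EX] [NormedSpace ℂ EX]
    {K : Type*} [Group K] [TopologicalSpace K] [ChartedSpace EK K] [LieGroup 𝓘(ℂ, EK) ω K]
    {X : Type*} [TopologicalSpace X] [ChartedSpace EX X] [IsManifold 𝓘(ℂ, EX) ω X]
    [MulAction K X] [ContMDiffSMul 𝓘(ℂ, EK) 𝓘(ℂ, EX) ω K X]
    {y : X} {v : EK} (hv : actionDeriv EK EX K y v = 0) : v ∈ stabLie EK K y := by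
  have : IsManifold 𝓘(ℝ, EX) 1 X := .of_le (n := ω) le_top
  set γ : ℝ → K := fun t ↦ lieExp (E := EK) (t • v : EK)
  have hγ : IsOneParameterSubgroup (E := EK) γ v := isOneParameterSubgroup_lieExp v
  have hvel (s : ℝ) : HasVelocityAt (fun t ↦ γ t • y) (0 : EX) s := by
    have horbit : HasVelocityAt (fun t ↦ γ (t - s) • y) (0 : EX) s := by
      simpa [hv] using (hasModelDerivAt_smul_point (EK := EK) (EX := EX) y).comp_velocity
        (hγ.hasVelocityAt_sub s) (by rw [sub_self, hγ.map_zero])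
    have hsmul : ContMDiff 𝓘(ℂ, EX) 𝓘(ℂ, EX) ω fun z : X ↦ γ s • z :=
      ContMDiffSMul.contMDiff_const_smul (I := 𝓘(ℂ, EK)) (γ s)
    have hmap := (hasModelDerivAt_modelDeriv ((contMDiff_real_of_complex hsmul).mdifferentiable
      (by simp) (γ (s - s) • y))).comp_velocity horbit rfl
    simpa only [smul_smul, ← hγ.1, add_sub_cancel, map_zero] using hmap
  intro t
  have hconst : γ t • y = γ 0 • y := eq_of_hasVelocityAt_zero hvel t 0
  rwa [hγ.map_zero, one_smul] at hconst

/-! ### Critical points of the potential -/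

section CriticalPoints

variable {EL : Type*} [NormedAddCommGroup EL] [NormedSpace ℝ EL] [FiniteDimensional ℝ EL]
  {EK : Type*} [NormedAddCommGroup EK] [NormedSpace ℂ EK] [CompleteSpace EK]
  {EX : Type*} [NormedAddCommGroup EX] [NormedSpace ℂ EX]
  {L : Type*} [Group L] [TopologicalSpace L] [ChartedSpace EL L] [LieGroup 𝓘(ℝ, EL) ∞ L]
  {K : Type*} [Group K] [TopologicalSpace K] [ChartedSpace EK K] [LieGroup 𝓘(ℂ, EK) ω K]
  {ι : L →* K} (hι : IsComplexification (EL := EL) (EK := EK) ι)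
  {X : Type*} [TopologicalSpace X] [ChartedSpace EX X] [IsManifold 𝓘(ℂ, EX) ω X] [MulAction K X]
  [ContMDiffSMul 𝓘(ℂ, EK) 𝓘(ℂ, EX) ω K X]
  {g : Bundle.ContMDiffRiemannianMetric 𝓘(ℝ, EX) ∞ EX (fun x : X ↦ TangentSpace 𝓘(ℝ, EX) x)}
  {m : X → Module.Dual ℝ (GroupLieAlgebra 𝓘(ℝ, EL) L)}
  (hm : IsHermitianMomentMap ι g m)

omit [FiniteDimensional ℝ EL] [LieGroup 𝓘(ℝ, EL) ∞ L] in
theorem orbitForm_pos_of_notMem_stabIm (g : Bundle.ContMDiffRiemannianMetric 𝓘(ℝ, EX) ∞ EX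
      (fun x : X ↦ TangentSpace 𝓘(ℝ, EX) x)) {y : X} {ξ : EL} (hξ : ξ ∉ stabIm EL EK ι y) :
    0 < orbitForm EK K g y (lieMapL EL EK ι ξ) (lieMapL EL EK ι ξ) := by
  refine (orbitForm_self_nonneg g y _).lt_of_ne' fun hzero ↦ hξ ⟨(0 : EL), ?_⟩
  have hv : actionDeriv EK EX K y (complexLieL EL EK ι (0, ξ)) = 0 := by
    rw [complexLieL, ContinuousLinearMap.coprod_apply, map_zero, zero_add,
      smul_apply, map_smul,
      actionDeriv_eq_zero_of_orbitForm_self_eq_zero hzero, smul_zero]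
  exact mem_stabLie_of_actionDeriv_eq_zero (EX := EX) (v := complexLieL EL EK ι ((0 : EL), ξ)) hv

include hι hm

namespace IsHermitianMomentMap

theorem potential_nonneg {y : X} (hy : momentL m y = 0) (k : K) :
    0 ≤ potential EK ι m 0 y (leftCoset ι k) := by
  have hle := add_mul_sub_le_of_convexOn_of_hasDerivAt
    (hm.convexOn_potential hι y (hι.polarLog k)) (hm.hasDerivAt_potential hι y _ 0) zero_le_one
  have hzero : potential EK ι m 0 y (leftCoset ι 1) = 0 :=
    (hm.isNormalizedPrimitive_potential hι y).normalized
  rw [← hι.map_polarL_mul_polarExp_polarLog k, leftCoset_map_mul]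
  simpa [polarMoment, polarExp_zero, hy, hzero] using hle

theorem potential_mul_stabilizer {y : X} (hy : momentL m y = 0) {γ : K}
    (hγ : γ ∈ MulAction.stabilizer K y) (h : K) :
    potential EK ι m 0 y (leftCoset ι (h * γ)) = potential EK ι m 0 y (leftCoset ι h) := by
  have hγy : γ • y = y := hγ
  have hinv := hm.potential_mul hι y γ⁻¹ γ
  rw [inv_mul_cancel, (hm.isNormalizedPrimitive_potential hι y).normalized, hγy] at hinv
  have hγ_eq : potential EK ι m 0 y (leftCoset ι γ) = 0 := by
    linarith [hm.potential_nonneg hι hy γ, hm.potential_nonneg hι hy γ⁻¹]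
  rw [hm.potential_mul hι, hγy, hγ_eq, add_zero]

theorem tendsto_potential {y : X} (hy : momentL m y = 0) {ξ : EL} (hξ : ξ ∉ stabIm EL EK ι y) :
    Tendsto (fun t : ℝ ↦ potential EK ι m 0 y (leftCoset ι (polarExp EL EK ι (t • ξ))))
      atTop atTop := by
  have hmoment := hm.hasDerivAt_polarMoment hι y ξ 0
  rw [zero_smul, polarExp_zero, one_smul] at hmoment
  obtain ⟨t, -, ht⟩ := exists_pos_of_hasDerivAt_pos hmoment
    (orbitForm_pos_of_notMem_stabIm g hξ) (by simp [polarMoment, polarExp_zero, hy])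
  exact tendsto_atTop_of_convexOn_of_hasDerivAt_pos (hm.convexOn_potential hι y ξ)
    (hm.hasDerivAt_potential hι y ξ t) ht

theorem momentL_eq_zero_of_critical {x : X} {k : K}
    (hk : HasModelDerivAt ℝ (fun h : K ↦ potential EK ι m 0 x (leftCoset ι h)) k
      (0 : EK →L[ℝ] ℝ)) : momentL m (k • x) = 0 := by
  ext ξ
  have hcurve := (hasModelDerivAt_mul_right ℝ EK k 1).comp_velocity
    (isOneParameterSubgroup_polarExp ι ξ).hasVelocityAt_zero
    (isOneParameterSubgroup_polarExp ι ξ).map_zero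
  have hderiv := hasVelocityAt_iff_hasDerivAt.1
    (hk.comp_velocity hcurve (by simp [polarExp_zero]))
  exact ((hm.isNormalizedPrimitive_potential hι x).hasDerivAt_polarExp k ξ).unique hderiv

theorem apply_eq_zero_of_shortest {q : EL →L[ℝ] EL →L[ℝ] ℝ} (hq : IsInvariantForm L q) {y : X}
    (hinv : ∀ γ ∈ MulAction.stabilizer K y, ∀ h : K,
      potential EK ι m 0 y (leftCoset ι (h * γ)) = potential EK ι m 0 y (leftCoset ι h))
    {ξ : EL} (hξ : ∀ η, radialPotential EL EK ι m y η = radialPotential EL EK ι m y ξ →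
      q ξ ξ ≤ q η η) {b : EL} (hb : b ∈ stabIm EL EK ι y) : q ξ b = 0 := by
  obtain ⟨a, ha⟩ := hb
  set v : EK := complexLieL EL EK ι (a, b)
  have hderiv := hq.hasDerivAt_polarLog_sq hι ξ v
  have hmin : IsLocalMin (fun t : ℝ ↦
      q (hι.polarLog (polarExp EL EK ι ξ * lieExp (E := EK) (G := K) (t • v : EK)))
        (hι.polarLog (polarExp EL EK ι ξ * lieExp (E := EK) (G := K) (t • v : EK)))) 0 := by
    refine .of_forall fun t ↦ ?_
    simp only [zero_smul, lieExp_zero, mul_one, hι.polarLog_polarExp]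
    refine hξ _ ?_
    have hcoset := hinv _ (ha t) (polarExp EL EK ι ξ)
    rw [hm.potential_leftCoset hι, hm.potential_leftCoset hι, hι.polarLog_polarExp] at hcoset
    exact hcoset
  have him : hι.im v = b := hι.im_add_I_smul a b
  simpa [him] using hmin.hasDerivAt_eq_zero hderiv

theorem exists_forall_radialPotential_le [CompactSpace L] {y : X}
    (hinv : ∀ γ ∈ MulAction.stabilizer K y, ∀ h : K,
      potential EK ι m 0 y (leftCoset ι (h * γ)) = potential EK ι m 0 y (leftCoset ι h))
    (htend : ∀ ξ : EL, ξ ∉ stabIm EL EK ι y →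
      Tendsto (fun t : ℝ ↦ potential EK ι m 0 y (leftCoset ι (polarExp EL EK ι (t • ξ))))
        atTop atTop) :
    ∃ ξ₀ : EL, ∀ ξ, radialPotential EL EK ι m y ξ₀ ≤ radialPotential EL EK ι m y ξ := by
  obtain ⟨q, hq⟩ := exists_isInvariantForm (EL := EL) (L := L)
  have hradial (ξ : EL) : (fun t : ℝ ↦ radialPotential EL EK ι m y (t • ξ))
      = fun t ↦ potential EK ι m 0 y (leftCoset ι (polarExp EL EK ι (t • ξ))) :=
    funext fun t ↦ by rw [hm.potential_leftCoset hι, hι.polarLog_polarExp]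
  refine exists_forall_le_of_convexOn_rays (V := stabIm EL EK ι y) hq.pos
    (continuous_iff_continuousAt.2 fun ξ ↦ (hm.hasFDerivAt_radialPotential hι y ξ).continuousAt)
    (fun ξ ↦ ?_) (fun ξ hξ ↦ ?_) (fun ξ hξ b hb ↦ hm.apply_eq_zero_of_shortest hι hq hinv hξ hb)
  · exact hradial ξ ▸ hm.convexOn_potential hι y ξ
  · exact hradial ξ ▸ htend ξ hξ

theorem hasCriticalPoint_of_forall_le {x : X} {k : K} {ξ₀ : EL}
    (hmin : ∀ ξ, radialPotential EL EK ι m (k • x) ξ₀ ≤ radialPotential EL EK ι m (k • x) ξ) :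
    HasCriticalPoint (EK := EK) ι (potential EK ι m 0 x) := by
  have hradial := hm.hasFDerivAt_radialPotential hι (k • x) ξ₀
  rw [IsLocalMin.hasFDerivAt_eq_zero (.of_forall hmin) hradial] at hradial
  have hcomp := (hasModelDerivAt_iff_hasFDerivAt.2
    (hradial.add_const (potential EK ι m 0 x (leftCoset ι k)))).comp
      (hι.hasModelDerivAt_polarLog_mul k⁻¹ (polarExp EL EK ι ξ₀ * k))
      (by rw [mul_inv_cancel_right, hι.polarLog_polarExp])
  rw [ContinuousLinearMap.zero_comp] at hcomp
  refine ⟨polarExp EL EK ι ξ₀ * k, hcomp.congr (.of_forall fun h ↦ ?_)⟩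
  rw [← hm.potential_leftCoset hι, ← hm.potential_mul hι, inv_mul_cancel_right]

end IsHermitianMomentMap

end CriticalPoints

section Translation

variable {EL : Type*} [NormedAddCommGroup EL] [NormedSpace ℝ EL]
  {EK : Type*} [NormedAddCommGroup EK] [NormedSpace ℂ EK]
  {L : Type*} [Group L] [TopologicalSpace L] [ChartedSpace EL L]
  {K : Type*} [Group K] [TopologicalSpace K] [ChartedSpace EK K]
  {X : Type*} [MulAction K X]
  (ι : L →* K) (m : X → Module.Dual ℝ (GroupLieAlgebra 𝓘(ℝ, EL) L))
  (ζ : Module.Dual ℝ (GroupLieAlgebra 𝓘(ℝ, EL) L)) (x : X)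

theorem isNormalizedPrimitive_sub_const :
    IsNormalizedPrimitive (EK := EK) ι (fun y ↦ m y - ζ) 0 x
      = IsNormalizedPrimitive (EK := EK) ι m ζ x := by
  ext Φ
  constructor
  · exact fun h ↦ ⟨h.differentiable, by simpa only [sub_zero] using h.deriv_eq, h.normalized⟩
  · exact fun h ↦ ⟨h.differentiable, by simpa only [sub_zero] using h.deriv_eq, h.normalized⟩

theorem potential_sub_const : potential EK ι (fun y ↦ m y - ζ) 0 x = potential EK ι m ζ x :=
  congrArg Classical.epsilon (isNormalizedPrimitive_sub_const ι m ζ x)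

end Translation

theorem expI_smul_eq_polarExp {EL : Type*} [NormedAddCommGroup EL] [NormedSpace ℝ EL]
    {EK : Type*} [NormedAddCommGroup EK] [NormedSpace ℂ EK]
    {L : Type*} [Group L] [TopologicalSpace L] [ChartedSpace EL L]
    {K : Type*} [Group K] [TopologicalSpace K] [ChartedSpace EK K]
    (ι : L →* K) (t : ℝ) (ξ : GroupLieAlgebra 𝓘(ℝ, EL) L) :
    expI (EK := EK) ι (t • ξ) = polarExp EL EK ι (t • (show EL from ξ)) :=
  expI_eq_polarExp ι (t • (show EL from ξ))

theorem proposition4p8_general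
    {EL : Type*} [NormedAddCommGroup EL] [NormedSpace ℝ EL] [FiniteDimensional ℝ EL]
    {EK : Type*} [NormedAddCommGroup EK] [NormedSpace ℂ EK]
    {EX : Type*} [NormedAddCommGroup EX] [NormedSpace ℂ EX]
    {L : Type*} [Group L] [TopologicalSpace L] [ChartedSpace EL L] [LieGroup 𝓘(ℝ, EL) ∞ L]
    [CompactSpace L]
    {K : Type*} [Group K] [TopologicalSpace K] [ChartedSpace EK K] [LieGroup 𝓘(ℂ, EK) ω K]
    (ι : L →* K) (hι : IsComplexification (EL := EL) (EK := EK) ι)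
    {X : Type*} [TopologicalSpace X] [ChartedSpace EX X] [IsManifold 𝓘(ℂ, EX) ω X]
    [MulAction K X] [ContMDiffSMul 𝓘(ℂ, EK) 𝓘(ℂ, EX) ω K X]
    (g : Bundle.ContMDiffRiemannianMetric 𝓘(ℝ, EX) ∞ EX (fun x : X ↦ TangentSpace 𝓘(ℝ, EX) x))
    (m : X → Module.Dual ℝ (GroupLieAlgebra 𝓘(ℝ, EL) L)) (hm : IsHermitianMomentMap ι g m)
    (ζ : Module.Dual ℝ (GroupLieAlgebra 𝓘(ℝ, EL) L))
    (hζ : ∀ (a : L) (ξ : GroupLieAlgebra 𝓘(ℝ, EL) L), ζ (lieAd a ξ) = ζ ξ)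
    (x : X) :
    (∃! Φ : LeftQuotient ι → ℝ, IsNormalizedPrimitive (EK := EK) ι m ζ x Φ) ∧
    (HasCriticalPoint (EK := EK) ι (potential EK ι m ζ x) ↔
      ∃ k : K,
        (∀ γ ∈ MulAction.stabilizer K (k • x), ∀ h : K,
          potential EK ι m ζ (k • x) (leftCoset ι (h * γ)) =
            potential EK ι m ζ (k • x) (leftCoset ι h)) ∧
        (∀ ξ : GroupLieAlgebra 𝓘(ℝ, EL) L, ξ ∉ stabIm EL EK ι (k • x) →
          Tendsto (fun t : ℝ ↦ potential EK ι m ζ (k • x) (leftCoset ι (expI (EK := EK) ι (t • ξ))))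
            atTop atTop)) := by
  have := hι.completeSpace
  have hm' := hm.sub_const hζ
  simp only [← potential_sub_const ι m ζ, ← isNormalizedPrimitive_sub_const ι m ζ,
    expI_smul_eq_polarExp]
  refine ⟨hm'.existsUnique_isNormalizedPrimitive hι x, ?_, ?_⟩
  · rintro ⟨k, hk⟩
    have hy := hm'.momentL_eq_zero_of_critical hι hk
    exact ⟨k, fun γ hγ h ↦ hm'.potential_mul_stabilizer hι hy hγ h,
      fun ξ hξ ↦ hm'.tendsto_potential hι hy hξ⟩
  · rintro ⟨k, hinv, htend⟩
    obtain ⟨ξ₀, hξ₀⟩ := hm'.exists_forall_radialPotential_le hι hinv htend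
    exact hm'.hasCriticalPoint_of_forall_le hι hξ₀

end

theorem proposition4p8
    {EL : Type*} [NormedAddCommGroup EL] [NormedSpace ℝ EL] [FiniteDimensional ℝ EL]
    {EK : Type*} [NormedAddCommGroup EK] [NormedSpace ℂ EK] [FiniteDimensional ℂ EK]
    {EX : Type*} [NormedAddCommGroup EX] [NormedSpace ℂ EX] [FiniteDimensional ℂ EX]
    -- the compact connected Lie group `L`
    {L : Type*} [Group L] [TopologicalSpace L] [ChartedSpace EL L] [LieGroup 𝓘(ℝ, EL) ∞ L]
    [T2Space L] [CompactSpace L] [ConnectedSpace L]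
    -- its complexification `K = L^ℂ`
    {K : Type*} [Group K] [TopologicalSpace K] [ChartedSpace EK K] [LieGroup 𝓘(ℂ, EK) ω K]
    (ι : L →* K) (hι : IsComplexification (EL := EL) (EK := EK) ι)
    -- the complex manifold `X` with the holomorphic action of `L^ℂ`
    {X : Type*} [TopologicalSpace X] [T2Space X] [ChartedSpace EX X] [IsManifold 𝓘(ℂ, EX) ω X]
    [MulAction K X] [ContMDiffSMul 𝓘(ℂ, EK) 𝓘(ℂ, EX) ω K X]
    -- the Kähler metric, preserved by `L`, and the moment map
    (g : KahlerMetric EX X) (hg : ActsIsometrically ι g)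
    (m : X → Module.Dual ℝ (GroupLieAlgebra 𝓘(ℝ, EL) L)) (hm : IsMomentMap ι g m)
    -- `ζ` is fixed by the coadjoint action
    (ζ : Module.Dual ℝ (GroupLieAlgebra 𝓘(ℝ, EL) L))
    (hζ : ∀ (a : L) (ξ : GroupLieAlgebra 𝓘(ℝ, EL) L), ζ (lieAd a ξ) = ζ ξ)
    (x : X) :
    (∃! Φ : LeftQuotient ι → ℝ, IsNormalizedPrimitive (EK := EK) ι m ζ x Φ) ∧
    (HasCriticalPoint (EK := EK) ι (potential EK ι m ζ x) ↔
      ∃ k : K,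
        (∀ γ ∈ MulAction.stabilizer K (k • x), ∀ h : K,
          potential EK ι m ζ (k • x) (leftCoset ι (h * γ)) =
            potential EK ι m ζ (k • x) (leftCoset ι h)) ∧
        (∀ ξ : GroupLieAlgebra 𝓘(ℝ, EL) L, ξ ∉ stabIm EL EK ι (k • x) →
          Tendsto (fun t : ℝ ↦ potential EK ι m ζ (k • x) (leftCoset ι (expI (EK := EK) ι (t • ξ))))
            atTop atTop)) := by
  exact proposition4p8_general ι hι g.toContMDiffRiemannianMetric m hm.isHermitianMomentMap ζ hζ x
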